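/- Let $M$ be an oriented smooth manifold of dimension $n$ (Hausdorff, $\sigma$-compact, without boundary), $G$ a finite-dimensional real Lie group with Lie algebra $\mathfrak g$, and $\rho:P\to M$ a smooth principal $G$-bundle. Let $CP=JP/G$ be the bundle of principal connections, whose sections are the principal connection forms on $P$, and let $J(CP)$ be its first order jet bundle. Let $P\times_G G$ be the gauge group bundle ($G$ acting on itself by conjugation); it acts on $P$ by $[p,g]\cdot(p\cdot g_0)=p\cdot(gg_0)$. Hence a local section $s$ of $P\times_G G$ transforms local connection forms $A$ into $s\cdot A=(\phi_s^{-1})^*A$, where $\phi_s(p)=s(\rho(p))\cdot p$, and this induces an action of the second order jet bundle $J^2(P\times_G G)$ on $J(CP)$, namely $j^2_m s\cdot j^1_m A=j^1_m(s\cdot A)$. Let $\mathrm{Gau}(P)$ be the group of $G$-equivariant diffeomorphisms $f$ of $P$ covering $\mathrm{id}_M$, acting on connection forms by $f\cdot A=(f^{-1})^*A$. Let $\mathcal L_{\mathrm{gauge}}:J(CP)\to\bigwedge^nT^*M$ be a smooth bundle map over $M$, and for every compact set $K\subset M$ and every smooth section $A$ of $CP$ put $$\mathcal S_K[A]=\int_K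 \mathcal L_{\mathrm{gauge}}(j^1A).$$ Suppose that $G$ is connected or that $P$ is trivial (i.e. has a global smooth section). Then the following are equivalent: (i) $\mathcal S_K[f\cdot A]=\mathcal S_K[A]$ for all compact $K\subset M$, all $f\in\mathrm{Gau}(P)$ and all smooth sections $A$ of $CP$; (ii) $\mathcal L_{\mathrm{gauge}}$ is invariant under the action of $J^2(P\times_G G)$ on $J(CP)$, i.e. $\mathcal L_{\mathrm{gauge}}(a\cdot j)=\mathcal L_{\mathrm{gauge}}(j)$ for all $m\in M$, $a\in J^2(P\times_G G)_m$ and $j\in J(CP)_m$. The implication (ii) $\Rightarrow$ (i) holds for every Lie group $G$ and every $P$. -/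

import Mathlib

open scoped Manifold ContDiff

noncomputable section

set_option linter.unusedSectionVars false

namespace GaugeField

section TangentMap

variable {E E' H H' N N' : Type*} [NormedAddCommGroup E] [NormedSpace ℝ E]
  [NormedAddCommGroup E'] [NormedSpace ℝ E'] [TopologicalSpace H] [TopologicalSpace H']
  [TopologicalSpace N] [ChartedSpace H N] [TopologicalSpace N'] [ChartedSpace H' N']
  (I : ModelWithCorners ℝ E H) (I' : ModelWithCorners ℝ E' H')

/-- The tangent map `mfderiv I I' f x`; as `TangentSpace I x` is the model space `E` by definition,
its type is written here as `E →L[ℝ] E'`. -/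
def tder (f : N → N') (x : N) : E →L[ℝ] E' := mfderiv I I' f x

variable {I I'}

lemma tder_comp {E'' H'' N'' : Type*} [NormedAddCommGroup E''] [NormedSpace ℝ E'']
    [TopologicalSpace H''] [TopologicalSpace N''] [ChartedSpace H'' N'']
    {I'' : ModelWithCorners ℝ E'' H''} {g : N' → N''} {f : N → N'} {x : N}
    (hg : MDifferentiableAt I' I'' g (f x)) (hf : MDifferentiableAt I I' f x) :
    tder I I'' (fun z => g (f z)) x = (tder I' I'' g (f x)).comp (tder I I' f x) :=
  mfderiv_comp x hg hf

lemma tder_congr {f g : N → N'} {x : N} (h : f =ᶠ[nhds x] g) : tder I I' f x = tder I I' g x :=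
  h.mfderiv_eq

lemma tder_eq_fderiv {f : E → E'} {x : E} : tder 𝓘(ℝ, E) 𝓘(ℝ, E') f x = fderiv ℝ f x :=
  mfderiv_eq_fderiv

/-- Equality of value, first and second derivative of two maps at `x`. -/
def Jet2Eq (f g : E → E') (x : E) : Prop :=
  f x = g x ∧ fderiv ℝ f x = fderiv ℝ g x ∧ fderiv ℝ (fderiv ℝ f) x = fderiv ℝ (fderiv ℝ g) x

lemma contDiffAt_fderiv {f : E → E'} {x : E} (h : ContDiffAt ℝ ∞ f x) :
    ContDiffAt ℝ ∞ (fderiv ℝ f) x := h.fderiv_right (by simp)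

lemma hasFDerivAt_fderiv_comp {E'' : Type*} [NormedAddCommGroup E''] [NormedSpace ℝ E'']
    {F : E' → E''} {f : E → E'} {x : E} (hF : ContDiffAt ℝ ∞ F (f x)) (hf : ContDiffAt ℝ ∞ f x) :
    HasFDerivAt (fun y => (fderiv ℝ F (f y)).comp (fderiv ℝ f y))
      ((ContinuousLinearMap.compL ℝ E E' E'' (fderiv ℝ F (f x))).comp (fderiv ℝ (fderiv ℝ f) x)
        + ((ContinuousLinearMap.compL ℝ E E' E'').flip (fderiv ℝ f x)).comp
          ((fderiv ℝ (fderiv ℝ F) (f x)).comp (fderiv ℝ f x))) x := by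
  refine HasFDerivAt.clm_comp ?_ ?_
  · exact HasFDerivAt.comp x ((contDiffAt_fderiv hF).differentiableAt (by simp)).hasFDerivAt
      (hf.differentiableAt (by simp)).hasFDerivAt
  · exact ((contDiffAt_fderiv hf).differentiableAt (by simp)).hasFDerivAt

lemma fderiv_comp_eventually {E'' : Type*} [NormedAddCommGroup E''] [NormedSpace ℝ E'']
    {F : E' → E''} {f : E → E'} {x : E} (hF : ContDiffAt ℝ ∞ F (f x)) (hf : ContDiffAt ℝ ∞ f x) :
    fderiv ℝ (fun y => F (f y)) =ᶠ[nhds x] fun y => (fderiv ℝ F (f y)).comp (fderiv ℝ f y) := by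
  have h1 : ∀ᶠ z in nhds (f x), ContDiffAt ℝ 1 F z :=
    (hF.of_le (by simp)).eventually (by simp)
  have h2 : ∀ᶠ z in nhds x, ContDiffAt ℝ 1 f z :=
    (hf.of_le (by simp)).eventually (by simp)
  filter_upwards [hf.continuousAt.eventually h1, h2] with y hy hy'
  exact fderiv_comp y (hy.differentiableAt (by simp)) (hy'.differentiableAt (by simp))

lemma Jet2Eq.comp {E'' : Type*} [NormedAddCommGroup E''] [NormedSpace ℝ E'']
    {F : E' → E''} {f g : E → E'} {x : E} (h : Jet2Eq f g x) (hF : ContDiffAt ℝ ∞ F (f x))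
    (hf : ContDiffAt ℝ ∞ f x) (hg : ContDiffAt ℝ ∞ g x) :
    Jet2Eq (fun y => F (f y)) (fun y => F (g y)) x := by
  obtain ⟨h0, h1, h2⟩ := h
  have hF' : ContDiffAt ℝ ∞ F (g x) := h0 ▸ hF
  have e1 := fderiv_comp_eventually hF hf
  have e2 := fderiv_comp_eventually hF' hg
  refine ⟨by simp only [h0], ?_, ?_⟩
  · rw [e1.self_of_nhds, e2.self_of_nhds]
    simp only [h0, h1]
  · rw [e1.fderiv_eq, e2.fderiv_eq, (hasFDerivAt_fderiv_comp hF hf).fderiv,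
      (hasFDerivAt_fderiv_comp hF' hg).fderiv, h0, h1, h2]

lemma Jet2Eq.prodMk {f g : E → E'} {x : E} (h : Jet2Eq f g x)
    (hf : ContDiffAt ℝ ∞ f x) (hg : ContDiffAt ℝ ∞ g x) :
    Jet2Eq (fun y => (y, f y)) (fun y => (y, g y)) x := by
  obtain ⟨h0, h1, h2⟩ := h
  have key : ∀ {k : E → E'}, ContDiffAt ℝ ∞ k x → fderiv ℝ (fun y => (y, k y)) =ᶠ[nhds x]
      fun y => ContinuousLinearMap.inl ℝ E E'
        + (ContinuousLinearMap.compL ℝ E E' (E × E') (ContinuousLinearMap.inr ℝ E E'))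
          (fderiv ℝ k y) := by
    intro k hk
    have h2 : ∀ᶠ z in nhds x, ContDiffAt ℝ 1 k z := (hk.of_le (by simp)).eventually (by simp)
    filter_upwards [h2] with y hy
    refine ((hasFDerivAt_id y).prodMk (hy.differentiableAt (by simp)).hasFDerivAt).fderiv.trans ?_
    ext v <;> simp
  have key2 : ∀ {k : E → E'}, ContDiffAt ℝ ∞ k x →
      fderiv ℝ (fderiv ℝ (fun y => (y, k y))) x
        = (ContinuousLinearMap.compL ℝ E E' (E × E') (ContinuousLinearMap.inr ℝ E E')).comp
          (fderiv ℝ (fderiv ℝ k) x) := by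
    intro k hk
    rw [(key hk).fderiv_eq, fderiv_const_add]
    exact ((ContinuousLinearMap.hasFDerivAt _).comp x
      ((contDiffAt_fderiv hk).differentiableAt (by simp)).hasFDerivAt).fderiv
  refine ⟨by simp only [h0], ?_, ?_⟩
  · rw [(key hf).self_of_nhds, (key hg).self_of_nhds]
    simp only [h1]
  · rw [key2 hf, key2 hg, h2]

end TangentMap

section Bundle

variable (n : ℕ) (EG EP M G P : Type*)
  [NormedAddCommGroup EG] [NormedSpace ℝ EG] [NormedAddCommGroup EP] [NormedSpace ℝ EP]
  [TopologicalSpace M] [ChartedSpace (EuclideanSpace ℝ (Fin n)) M]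
  [TopologicalSpace G] [ChartedSpace EG G] [Group G]
  [TopologicalSpace P] [ChartedSpace EP P]

/-- The given atlas of `M` is oriented: all coordinate changes have positive Jacobian. -/
def IsOrientedAtlas : Prop :=
  ∀ e ∈ atlas (EuclideanSpace ℝ (Fin n)) M, ∀ e' ∈ atlas (EuclideanSpace ℝ (Fin n)) M,
    ∀ x ∈ e.source ∩ e'.source, 0 < (fderiv ℝ (fun y => e' (e.symm y)) (e x)).det

/-- A smooth principal `G`-bundle `proj : P → M` with right action `act p g = p · g`. -/
structure PrincipalBundle where
  proj : P → M
  act : P → G → P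
  contMDiff_proj : ContMDiff 𝓘(ℝ, EP) (𝓡 n) ∞ proj
  contMDiff_act :
    ContMDiff (𝓘(ℝ, EP).prod 𝓘(ℝ, EG)) 𝓘(ℝ, EP) ∞ (fun x : P × G => act x.1 x.2)
  act_one : ∀ p, act p 1 = p
  act_mul : ∀ p g h, act (act p g) h = act p (g * h)
  proj_act : ∀ p g, proj (act p g) = proj p
  /-- Around every point there are a smooth local section `σ` and a smooth `τ` such that
  `(x, g) ↦ σ x · g` and `p ↦ (proj p, τ p)` are inverse diffeomorphisms
  between `U × G` and the part of `P` over `U`. -/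
  locallyTrivial : ∀ m : M, ∃ U : Set M, IsOpen U ∧ m ∈ U ∧ ∃ (σ : M → P) (τ : P → G),
    ContMDiffOn (𝓡 n) 𝓘(ℝ, EP) ∞ σ U ∧ (∀ x ∈ U, proj (σ x) = x) ∧
    ContMDiffOn 𝓘(ℝ, EP) 𝓘(ℝ, EG) ∞ τ (proj ⁻¹' U) ∧
    (∀ p ∈ proj ⁻¹' U, act (σ (proj p)) (τ p) = p) ∧
    (∀ x ∈ U, ∀ g, τ (act (σ x) g) = g)

end Bundle

section Main

variable {n : ℕ} {EG EP M G P : Type*}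
  [NormedAddCommGroup EG] [NormedSpace ℝ EG] [NormedAddCommGroup EP] [NormedSpace ℝ EP]
  [TopologicalSpace M] [ChartedSpace (EuclideanSpace ℝ (Fin n)) M]
  [TopologicalSpace G] [ChartedSpace EG G] [Group G]
  [TopologicalSpace P] [ChartedSpace EP P]
  (B : PrincipalBundle n EG EP M G P)

namespace PrincipalBundle

/-- `σ` is a smooth section of `P` over `U` (its values outside `U` are irrelevant). -/
def IsSectionOn (σ : M → P) (U : Set M) : Prop :=
  ContMDiffOn (𝓡 n) 𝓘(ℝ, EP) ∞ σ U ∧ ∀ x ∈ U, B.proj (σ x) = x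

variable {B} in
lemma act_free {p : P} {g h : G} (e : B.act p g = B.act p h) : g = h := by
  obtain ⟨U, -, hU, σ, τ, -, -, -, h1, h2⟩ := B.locallyTrivial (B.proj p)
  have := h1 p hU
  rw [← this, B.act_mul, B.act_mul] at e
  have e' := congrArg τ e
  rw [h2 _ hU, h2 _ hU] at e'
  exact mul_left_cancel e'

variable {B} in
lemma act_transitive {p q : P} (e : B.proj p = B.proj q) : ∃ g, B.act p g = q := by
  obtain ⟨U, -, hU, σ, τ, -, -, -, h1, h2⟩ := B.locallyTrivial (B.proj p)
  refine ⟨(τ p)⁻¹ * τ q, ?_⟩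
  have hp := h1 p hU
  have hq := h1 q (by rw [Set.mem_preimage, ← e]; exact hU)
  rw [← e] at hq
  calc B.act p ((τ p)⁻¹ * τ q) = B.act (B.act (B.act (σ (B.proj p)) (τ p)) (τ p)⁻¹) (τ q) := by
        rw [hp, B.act_mul]
    _ = q := by rw [B.act_mul (σ (B.proj p)), mul_inv_cancel, B.act_one, hq]

/-! ### The gauge group bundle `P ×_G G` -/

/-- The orbit relation of the action `k · (p, g) = (p · k⁻¹, k g k⁻¹)` of `G` on `P × G`. -/
def gaugeSetoid : Setoid (P × G) where
  r a b := ∃ k : G, b = (B.act a.1 k⁻¹, k * a.2 * k⁻¹)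
  iseqv :=
    { refl := fun a => ⟨1, by simp [B.act_one]⟩
      symm := by
        rintro ⟨p, g⟩ _ ⟨k, rfl⟩
        exact ⟨k⁻¹, by simp [B.act_mul, B.act_one, mul_assoc]⟩
      trans := by
        rintro ⟨p, g⟩ _ _ ⟨k, rfl⟩ ⟨l, rfl⟩
        exact ⟨l * k, by simp [B.act_mul, mul_assoc]⟩ }

/-- The gauge group bundle `P ×_G G`, with `G` acting on itself by conjugation. -/
def GaugeBundle : Type _ := Quotient B.gaugeSetoid

/-- The class `[p, g]`. -/
def gmk (p : P) (g : G) : B.GaugeBundle := Quotient.mk B.gaugeSetoid (p, g)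

/-- The projection `P ×_G G → M`. -/
def gproj (q : B.GaugeBundle) : M :=
  Quotient.lift (fun a : P × G => B.proj a.1)
    (by rintro a _ ⟨k, rfl⟩; simp [B.proj_act]) q

/-- Inversion `[p, g]⁻¹ = [p, g⁻¹]`. -/
def ginv (q : B.GaugeBundle) : B.GaugeBundle :=
  Quotient.map' (s₁ := B.gaugeSetoid) (s₂ := B.gaugeSetoid) (fun a : P × G => (a.1, a.2⁻¹))
    (by rintro a _ ⟨k, rfl⟩; exact ⟨k, by simp [mul_assoc]⟩) q

/-- For `q` in the fibre of `P ×_G G` over `proj p`, the unique `g` with `q = [p, g]`. -/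
def gcoord (q : B.GaugeBundle) (p : P) : G := Classical.epsilon fun g => q = B.gmk p g

variable {B} in
lemma gmk_inj {p : P} {g h : G} (e : B.gmk p g = B.gmk p h) : g = h := by
  obtain ⟨k, hk⟩ := Quotient.exact e
  simp only [Prod.mk.injEq] at hk
  have : k⁻¹ = 1 := act_free (p := p) (B := B) (by rw [← hk.1, B.act_one])
  rw [inv_eq_one] at this
  simpa [this] using hk.2.symm

lemma gmk_act (p : P) (k g : G) : B.gmk (B.act p k) g = B.gmk p (k * g * k⁻¹) :=
  Quotient.sound ⟨k, by simp [B.act_mul, B.act_one]⟩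

variable {B} in
lemma gmk_gcoord {q : B.GaugeBundle} {p : P} (e : B.gproj q = B.proj p) :
    q = B.gmk p (B.gcoord q p) := by
  refine Classical.epsilon_spec (p := fun g => q = B.gmk p g) ?_
  induction q using Quotient.inductionOn with
  | h a =>
    obtain ⟨p', g⟩ := a
    obtain ⟨k, hk⟩ := act_transitive (B := B) (p := p) (q := p') e.symm
    refine ⟨k * g * k⁻¹, ?_⟩
    rw [← B.gmk_act, hk]; rfl

variable {B} in
@[simp] lemma gcoord_gmk (p : P) (g : G) : B.gcoord (B.gmk p g) p = g :=
  (gmk_inj (gmk_gcoord (B := B) (q := B.gmk p g) (p := p) rfl)).symm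

variable {B} in
lemma gcoord_act {q : B.GaugeBundle} {p : P} (e : B.gproj q = B.proj p) (k : G) :
    B.gcoord q (B.act p k) = k⁻¹ * B.gcoord q p * k := by
  have h1 := gmk_gcoord e
  have h2 := gmk_gcoord (B := B) (q := q) (p := B.act p k) (by rw [e, B.proj_act])
  rw [B.gmk_act] at h2
  rw [gmk_inj (h1.symm.trans h2)]
  group

variable {B} in
lemma gcoord_ginv {q : B.GaugeBundle} {p : P} (e : B.gproj q = B.proj p) :
    B.gcoord (B.ginv q) p = (B.gcoord q p)⁻¹ := by
  conv_lhs => rw [gmk_gcoord e]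
  exact gcoord_gmk p _

lemma gproj_ginv (q : B.GaugeBundle) : B.gproj (B.ginv q) = B.gproj q := by
  induction q using Quotient.inductionOn with
  | h a => rfl

/-- The fibrewise left action of `P ×_G G` on `P`: `[p, g] · p = p · g`, whence
`[p, g] · (p · g₀) = p · (g g₀)`. -/
def gact (q : B.GaugeBundle) (p : P) : P := B.act p (B.gcoord q p)

/-- The `G`-valued function `p ↦ g`, `s (proj p) = [p, g]`, that represents `s` on `P`. -/
def gfun (s : M → B.GaugeBundle) (p : P) : G := B.gcoord (s (B.proj p)) p

end PrincipalBundle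

open PrincipalBundle TopologicalSpace

variable [LieGroup 𝓘(ℝ, EG) ∞ G] [IsManifold 𝓘(ℝ, EP) ∞ P]

/-- A smooth section of `P ×_G G` over the open set `U` (values outside `U` are irrelevant).
Smoothness is expressed after pulling back to `P`, which is equivalent since `P → M` has
smooth local sections. -/
structure GaugeSection (U : Opens M) where
  sec : M → B.GaugeBundle
  gproj_sec : ∀ x ∈ U, B.gproj (sec x) = x
  smooth : ContMDiffOn 𝓘(ℝ, EP) 𝓘(ℝ, EG) ∞ (B.gfun sec) (B.proj ⁻¹' U)

/-- Local smooth sections of `P ×_G G` around `m`. -/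
def LocalGauge (m : M) : Type _ := Σ U : {U : Opens M // m ∈ U}, GaugeSection B U.1

/-- The 2-jet at `p` of `u : P → G`: value, first and second derivative in the preferred charts. -/
def jet2 (u : P → G) (p : P) : G × (EP →L[ℝ] EG) × (EP →L[ℝ] EP →L[ℝ] EG) :=
  let w : EP → EG := writtenInExtChartAt 𝓘(ℝ, EP) 𝓘(ℝ, EG) p u
  let y : EP := extChartAt 𝓘(ℝ, EP) p p
  (u p, fderiv ℝ w y, fderiv ℝ (fderiv ℝ w) y)

/-- Two local sections of `P ×_G G` have the same 2-jet at `m`. Since they are represented by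
equivariant functions on `P`, this is tested along the fibre of `P` over `m`. -/
def jet2Setoid (m : M) : Setoid (LocalGauge B m) where
  r s t := ∀ p, B.proj p = m → jet2 (EG := EG) (EP := EP) (B.gfun s.2.sec) p
    = jet2 (EG := EG) (EP := EP) (B.gfun t.2.sec) p
  iseqv := ⟨fun _ _ _ => rfl, fun h p hp => (h p hp).symm,
    fun h h' p hp => (h p hp).trans (h' p hp)⟩

/-- The fibre over `m` of the second order derived gauge group bundle `J²(P ×_G G)`. -/
def J2Gauge (m : M) : Type _ := Quotient (jet2Setoid B m)

/-! ### The connection bundle `CP` and its first jet bundle -/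

/-- The fundamental vector field `X ↦ d/dt p · exp (t X)` at `p`. -/
def fundamental (p : P) : EG →L[ℝ] EP :=
  tder 𝓘(ℝ, EG) 𝓘(ℝ, EP) (fun g : G => B.act p g) 1

variable (EG) in
/-- `Ad (g⁻¹)`, the derivative at `1` of `h ↦ g⁻¹ h g`. -/
def AdInv (g : G) : EG →L[ℝ] EG :=
  tder 𝓘(ℝ, EG) 𝓘(ℝ, EG) (fun h : G => g⁻¹ * h * g) 1

/-- The fibre of `CP = JP / G` over `m`, in terms of connection forms on the fibre of `P` over `m`:
`G`-equivariant `𝔤`-valued forms on `TP` along that fibre, restricting to the canonical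
isomorphism on vertical vectors. Here `TangentSpace 𝓘(ℝ, EP) p = EP` and `𝔤 = T₁G = EG`. -/
structure ConnFiber (m : M) where
  form : ∀ p : P, B.proj p = m → (EP →L[ℝ] EG)
  equivariant : ∀ (p : P) (hp : B.proj p = m) (g : G) (v : EP),
    form (B.act p g) ((B.proj_act p g).trans hp)
        (tder 𝓘(ℝ, EP) 𝓘(ℝ, EP) (fun q => B.act q g) p v)
      = AdInv EG g (form p hp v)
  vertical : ∀ (p : P) (hp : B.proj p = m) (X : EG), form p hp (fundamental B p X) = X

/-- The 1-form on the part of `P` over `U` given by a section of `CP` over `U` (`0` elsewhere). -/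
def formOf (U : Opens M) (sec : ∀ x : U, ConnFiber B x.1) (p : P) : EP →L[ℝ] EG :=
  open Classical in if h : B.proj p ∈ U then (sec ⟨B.proj p, h⟩).form p rfl else 0

/-- A `𝔤`-valued 1-form on `P` as a function on `TP`. -/
def formFun (A : P → (EP →L[ℝ] EG)) (v : TangentBundle 𝓘(ℝ, EP) P) : EG := A v.proj v.2

/-- A smooth section of `CP` over the open set `U`, i.e. a principal connection form on the part
of `P` over `U`; smoothness of the form means smoothness as a function on `TP`. -/
structure ConnSection (U : Opens M) where
  sec : ∀ x : U, ConnFiber B x.1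
  smooth : ContMDiffOn 𝓘(ℝ, EP).tangent 𝓘(ℝ, EG) ∞
    (formFun (formOf B U sec)) {v | B.proj v.proj ∈ U}

/-- The connection form of a section of `CP`. -/
def ConnSection.form {B : PrincipalBundle n EG EP M G P} {U : Opens M} (A : ConnSection B U) :
    P → (EP →L[ℝ] EG) := formOf B U A.sec

/-- Local smooth sections of `CP` around `m`. -/
def LocalConn (m : M) : Type _ := Σ U : {U : Opens M // m ∈ U}, ConnSection B U.1

/-- The expression of a 1-form on `P` in the preferred chart at `p₀`. -/
def formInChart (A : P → (EP →L[ℝ] EG))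
    (p₀ : P) (y : EP) : EP →L[ℝ] EG :=
  (A ((extChartAt 𝓘(ℝ, EP) p₀).symm y)).comp
    (tder 𝓘(ℝ, EP) 𝓘(ℝ, EP) (extChartAt 𝓘(ℝ, EP) p₀).symm y)

/-- The 1-jet at `p` of a 1-form on `P`: value and first derivative in the preferred chart. -/
def formJet1 (A : P → (EP →L[ℝ] EG)) (p : P) :
    (EP →L[ℝ] EG) × (EP →L[ℝ] EP →L[ℝ] EG) :=
  (formInChart A p (extChartAt 𝓘(ℝ, EP) p p),
    fderiv ℝ (formInChart A p) (extChartAt 𝓘(ℝ, EP) p p))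

/-- Two local sections of `CP` have the same 1-jet at `m`. Since they are equivariant forms
on `P`, this is tested along the fibre of `P` over `m`. -/
def jet1Setoid (m : M) : Setoid (LocalConn B m) where
  r A A' := ∀ p, B.proj p = m → formJet1 A.2.form p = formJet1 A'.2.form p
  iseqv := ⟨fun _ _ _ => rfl, fun h p hp => (h p hp).symm,
    fun h h' p hp => (h p hp).trans (h' p hp)⟩

/-- The fibre over `m` of the first jet bundle `J(CP)` of the connection bundle. -/
def JConn (m : M) : Type _ := Quotient (jet1Setoid B m)

/-! ### Actions -/

variable {B} in
lemma formOf_eq {U : Opens M} {sec : ∀ x : U, ConnFiber B x.1} {x : M} (hx : x ∈ U) (p : P)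
    (hp : B.proj p = x) : formOf B U sec p = (sec ⟨x, hx⟩).form p hp := by
  subst hp
  simp [formOf, hx]

/-- `φ` restricts over `U` to a smooth bundle map of `P` to itself over the identity. -/
structure IsLocalAut (U : Opens M) (φ : P → P) : Prop where
  smooth : ContMDiffOn 𝓘(ℝ, EP) 𝓘(ℝ, EP) ∞ φ (B.proj ⁻¹' U)
  proj_eq : ∀ p, B.proj p ∈ U → B.proj (φ p) = B.proj p
  act_eq : ∀ p g, B.proj p ∈ U → φ (B.act p g) = B.act (φ p) g

variable {B}

lemma isOpen_over (U : Opens M) : IsOpen (B.proj ⁻¹' U) :=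
  U.isOpen.preimage B.contMDiff_proj.continuous

lemma IsLocalAut.mdiffAt {U : Opens M} {φ : P → P} (h : IsLocalAut B U φ) {p : P}
    (hp : B.proj p ∈ U) : MDifferentiableAt 𝓘(ℝ, EP) 𝓘(ℝ, EP) φ p :=
  (h.smooth.contMDiffAt ((isOpen_over U).mem_nhds hp)).mdifferentiableAt (by simp)

lemma mdiff_act_right (g : G) :
    ContMDiff 𝓘(ℝ, EP) 𝓘(ℝ, EP) ∞ (fun p => B.act p g) :=
  B.contMDiff_act.comp (contMDiff_id.prodMk contMDiff_const)

lemma mdiff_act_left (p : P) :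
    ContMDiff 𝓘(ℝ, EG) 𝓘(ℝ, EP) ∞ (fun g => B.act p g) :=
  B.contMDiff_act.comp (contMDiff_const.prodMk contMDiff_id)

lemma ConnFiber.form_congr {m : M} (A : ConnFiber B m) {p q : P} (e : p = q)
    (hp : B.proj p = m) (hq : B.proj q = m) (v : EP) : A.form p hp v = A.form q hq v := by
  subst e; rfl

/-- Pull-back of a section of `CP` (a connection form) by an automorphism. -/
def ConnSection.pullback {U V : Opens M} (A : ConnSection B V) (φ : P → P)
    (h : IsLocalAut B U φ) (hUV : U ≤ V) : ConnSection B U where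
  sec x :=
    { form := fun p hp =>
        ((A.sec ⟨x.1, hUV x.2⟩).form (φ p) ((h.proj_eq p (hp ▸ x.2)).trans hp)).comp
          (tder 𝓘(ℝ, EP) 𝓘(ℝ, EP) φ p)
      equivariant := by
        intro p hp g v
        have hpU : B.proj p ∈ U := hp ▸ x.2
        have hgU : B.proj (B.act p g) ∈ U := by rwa [B.proj_act]
        have h1 := tder_comp (I := 𝓘(ℝ, EP)) (I' := 𝓘(ℝ, EP)) (I'' := 𝓘(ℝ, EP)) (x := p)
          (f := fun q => B.act q g) (g := φ)
          (h.mdiffAt hgU) ((mdiff_act_right (B := B) g).mdifferentiableAt (by simp))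
        have h2 := tder_comp (I := 𝓘(ℝ, EP)) (I' := 𝓘(ℝ, EP)) (I'' := 𝓘(ℝ, EP)) (x := p)
          (g := fun q => B.act q g) (f := φ)
          ((mdiff_act_right (B := B) g).mdifferentiableAt (by simp)) (h.mdiffAt hpU)
        have h3 : (fun q => φ (B.act q g)) =ᶠ[nhds p] (fun q => B.act (φ q) g) := by
          filter_upwards [(isOpen_over U).mem_nhds hpU] with q hq
          exact h.act_eq q g hq
        rw [tder_congr h3, h2] at h1
        rw [ContinuousLinearMap.comp_apply, ← ContinuousLinearMap.comp_apply (tder _ _ φ _), ← h1,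
          ContinuousLinearMap.comp_apply, ContinuousLinearMap.comp_apply,
          ← (A.sec ⟨x.1, hUV x.2⟩).equivariant]
        exact ConnFiber.form_congr _ (h.act_eq p g hpU) _ _ _
      vertical := by
        intro p hp X
        have hpU : B.proj p ∈ U := hp ▸ x.2
        have h1 := tder_comp (I := 𝓘(ℝ, EG)) (I' := 𝓘(ℝ, EP)) (I'' := 𝓘(ℝ, EP)) (x := (1 : G))
          (f := fun g => B.act p g) (g := φ)
          (h.mdiffAt (by rwa [B.proj_act]))
          ((mdiff_act_left (B := B) p).mdifferentiableAt (by simp))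
        have h2 : (fun g => φ (B.act p g)) = fun g => B.act (φ p) g :=
          funext fun g => h.act_eq p g hpU
        simp only [h2, B.act_one] at h1
        rw [ContinuousLinearMap.comp_apply, fundamental,
          ← ContinuousLinearMap.comp_apply (tder _ _ φ _), ← h1]
        exact (A.sec ⟨x.1, hUV x.2⟩).vertical _ _ X }
  smooth := by
    have h1 : ContMDiffOn 𝓘(ℝ, EP).tangent 𝓘(ℝ, EP).tangent ∞ (tangentMap 𝓘(ℝ, EP) 𝓘(ℝ, EP) φ)
        {v | B.proj v.proj ∈ U} := by
      refine (h.smooth.contMDiffOn_tangentMapWithin (m := ∞) (by simp)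
        (isOpen_over U).uniqueMDiffOn).congr ?_
      intro v hv
      rw [tangentMapWithin, tangentMap, mfderivWithin_of_isOpen (isOpen_over U) hv]
    refine (A.smooth.comp h1 ?_).congr ?_
    · intro v hv
      change B.proj (φ v.proj) ∈ V
      rw [h.proj_eq _ hv]
      exact hUV hv
    · intro v hv
      have hv' : B.proj v.proj ∈ U := hv
      change formOf B U _ v.proj v.2 = formOf B V A.sec (φ v.proj)
        (tder 𝓘(ℝ, EP) 𝓘(ℝ, EP) φ v.proj v.2)
      rw [formOf_eq hv' _ rfl, formOf_eq (hUV hv') _ (h.proj_eq _ hv)]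
      rfl

lemma ConnSection.pullback_form {U V : Opens M} (A : ConnSection B V) (φ : P → P)
    (h : IsLocalAut B U φ) (hUV : U ≤ V) {p : P} (hp : B.proj p ∈ U) :
    (A.pullback φ h hUV).form p = (A.form (φ p)).comp (tder 𝓘(ℝ, EP) 𝓘(ℝ, EP) φ p) := by
  rw [ConnSection.form, ConnSection.form, formOf_eq hp _ rfl,
    formOf_eq (hUV hp) _ (h.proj_eq _ hp)]
  rfl

/-- The inverse `p ↦ (s (proj p))⁻¹ · p` of the transformation of `P` defined by a section `s`
of `P ×_G G`. -/
def GaugeSection.invMap {U : Opens M} (s : GaugeSection B U) (p : P) : P :=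
  B.gact (B.ginv (s.sec (B.proj p))) p

lemma GaugeSection.invMap_eq {U : Opens M} (s : GaugeSection B U) {p : P} (hp : B.proj p ∈ U) :
    s.invMap p = B.act p (B.gfun s.sec p)⁻¹ := by
  rw [GaugeSection.invMap, gact, gcoord_ginv (s.gproj_sec _ hp), gfun]

lemma GaugeSection.isLocalAut {U : Opens M} (s : GaugeSection B U) :
    IsLocalAut B U s.invMap where
  smooth := by
    have h : ContMDiffOn 𝓘(ℝ, EP) 𝓘(ℝ, EP) ∞ (fun p => B.act p (B.gfun s.sec p)⁻¹)
        (B.proj ⁻¹' U) :=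
      B.contMDiff_act.comp_contMDiffOn (contMDiffOn_id.prodMk s.smooth.inv)
    exact h.congr fun p hp => s.invMap_eq hp
  proj_eq p hp := by simp [GaugeSection.invMap, gact, B.proj_act]
  act_eq p g hp := by
    have hp' : B.proj (B.act p g) ∈ U := by rwa [B.proj_act]
    rw [s.invMap_eq hp, s.invMap_eq hp', gfun, B.proj_act, gcoord_act (s.gproj_sec _ hp),
      ← gfun, B.act_mul, B.act_mul]
    congr 1
    group


/-! The transformed 1-jet depends only on the jets of the data. -/

/-- `f` in the preferred charts at `p` and at `q`. -/
def hat {E E' N N' : Type*} [NormedAddCommGroup E] [NormedSpace ℝ E] [NormedAddCommGroup E']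
    [NormedSpace ℝ E'] [TopologicalSpace N] [ChartedSpace E N] [TopologicalSpace N']
    [ChartedSpace E' N'] (p : N) (q : N') (f : N → N') (y : E) : E' :=
  extChartAt 𝓘(ℝ, E') q (f ((extChartAt 𝓘(ℝ, E) p).symm y))

lemma contMDiffAt_chart_symm {E N : Type*} [NormedAddCommGroup E] [NormedSpace ℝ E]
    [TopologicalSpace N] [ChartedSpace E N] [IsManifold 𝓘(ℝ, E) ∞ N] (p : N) {y : E}
    (hy : y ∈ (extChartAt 𝓘(ℝ, E) p).target) :
    ContMDiffAt 𝓘(ℝ, E) 𝓘(ℝ, E) ∞ (extChartAt 𝓘(ℝ, E) p).symm y :=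
  (contMDiffOn_extChartAt_symm p).contMDiffAt ((isOpen_extChartAt_target p).mem_nhds hy)

lemma contDiffAt_hat {E E' N N' : Type*} [NormedAddCommGroup E] [NormedSpace ℝ E]
    [NormedAddCommGroup E'] [NormedSpace ℝ E'] [TopologicalSpace N] [ChartedSpace E N]
    [TopologicalSpace N'] [ChartedSpace E' N'] [IsManifold 𝓘(ℝ, E) ∞ N]
    [IsManifold 𝓘(ℝ, E') ∞ N'] {p : N} {q : N'} {f : N → N'} {y : E}
    (hy : y ∈ (extChartAt 𝓘(ℝ, E) p).target)
    (hf : ContMDiffAt 𝓘(ℝ, E) 𝓘(ℝ, E') ∞ f ((extChartAt 𝓘(ℝ, E) p).symm y))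
    (hq : f ((extChartAt 𝓘(ℝ, E) p).symm y) ∈ (extChartAt 𝓘(ℝ, E') q).source) :
    ContDiffAt ℝ ∞ (hat (E := E) (E' := E') p q f) y := by
  rw [← contMDiffAt_iff_contDiffAt]
  rw [extChartAt_source] at hq
  exact (contMDiffAt_extChartAt' hq).comp y (hf.comp y (contMDiffAt_chart_symm p hy))

lemma jet2Eq_of_jet2 {u v : P → G} {p : P} (h : jet2 (EG := EG) (EP := EP) u p = jet2 v p) :
    u p = v p ∧ Jet2Eq (hat (E := EP) (E' := EG) p (u p) u) (hat p (u p) v)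
      (extChartAt 𝓘(ℝ, EP) p p) := by
  simp only [jet2, Prod.mk.injEq] at h
  obtain ⟨h0, h1, h2⟩ := h
  refine ⟨h0, ?_, ?_, ?_⟩
  · simp [hat, h0]
  · rw [h0]
    simp only [writtenInExtChartAt, h0] at h1
    exact h1
  · rw [h0]
    simp only [writtenInExtChartAt, h0] at h2
    exact h2

lemma invMap_jet {U U' : Opens M} (s : GaugeSection B U) (t : GaugeSection B U') {p : P}
    (hU : B.proj p ∈ U) (hU' : B.proj p ∈ U')
    (h : jet2 (EG := EG) (EP := EP) (B.gfun s.sec) p = jet2 (B.gfun t.sec) p) :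
    s.invMap p = t.invMap p ∧
    Jet2Eq (hat (E := EP) (E' := EP) p (s.invMap p) s.invMap) (hat p (s.invMap p) t.invMap)
      (extChartAt 𝓘(ℝ, EP) p p) := by
  have : IsManifold 𝓘(ℝ, EG) ∞ G := inferInstance
  obtain ⟨h0, hj⟩ := jet2Eq_of_jet2 h
  set u := B.gfun s.sec with hu
  set v := B.gfun t.sec with hv
  have e0 : s.invMap p = t.invMap p := by rw [s.invMap_eq hU, t.invMap_eq hU', ← hu, ← hv, h0]
  refine ⟨e0, ?_⟩
  set y₀ := extChartAt 𝓘(ℝ, EP) p p with hy₀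
  have hy : y₀ ∈ (extChartAt 𝓘(ℝ, EP) p).target := mem_extChartAt_target p
  have hx : (extChartAt 𝓘(ℝ, EP) p).symm y₀ = p := extChartAt_to_inv p
  have su : ContMDiffAt 𝓘(ℝ, EP) 𝓘(ℝ, EG) ∞ u p :=
    s.smooth.contMDiffAt ((isOpen_over U).mem_nhds hU)
  have sv : ContMDiffAt 𝓘(ℝ, EP) 𝓘(ℝ, EG) ∞ v p :=
    t.smooth.contMDiffAt ((isOpen_over U').mem_nhds hU')
  have cu : ContDiffAt ℝ ∞ (hat (E := EP) (E' := EG) p (u p) u) y₀ :=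
    contDiffAt_hat hy (by rwa [hx]) (by rw [hx]; exact mem_extChartAt_source _)
  have cv : ContDiffAt ℝ ∞ (hat (E := EP) (E' := EG) p (u p) v) y₀ :=
    contDiffAt_hat hy (by rwa [hx]) (by rw [hx, ← h0]; exact mem_extChartAt_source _)
  let F : EP × EG → EP := fun z => extChartAt 𝓘(ℝ, EP) (s.invMap p)
    (B.act ((extChartAt 𝓘(ℝ, EP) p).symm z.1) ((extChartAt 𝓘(ℝ, EG) (u p)).symm z.2)⁻¹)
  have hz : hat (E := EP) (E' := EG) p (u p) u y₀ = extChartAt 𝓘(ℝ, EG) (u p) (u p) := by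
    simp only [hat, hx]
  have cF : ContDiffAt ℝ ∞ F (y₀, hat (E := EP) (E' := EG) p (u p) u y₀) := by
    rw [← contMDiffAt_iff_contDiffAt, hz]
    have a1 : ContMDiffAt 𝓘(ℝ, EP × EG) 𝓘(ℝ, EP) ∞
        (fun z : EP × EG => (extChartAt 𝓘(ℝ, EP) p).symm z.1)
        (y₀, extChartAt 𝓘(ℝ, EG) (u p) (u p)) :=
      (contMDiffAt_chart_symm p hy).comp (y₀, extChartAt 𝓘(ℝ, EG) (u p) (u p))
        contDiffAt_fst.contMDiffAt
    have a2 : ContMDiffAt 𝓘(ℝ, EP × EG) 𝓘(ℝ, EG) ∞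
        (fun z : EP × EG => (extChartAt 𝓘(ℝ, EG) (u p)).symm z.2)
        (y₀, extChartAt 𝓘(ℝ, EG) (u p) (u p)) :=
      (contMDiffAt_chart_symm (u p) (mem_extChartAt_target _)).comp
        (y₀, extChartAt 𝓘(ℝ, EG) (u p) (u p)) contDiffAt_snd.contMDiffAt
    have a3 := B.contMDiff_act.contMDiffAt.comp
      (y₀, extChartAt 𝓘(ℝ, EG) (u p) (u p)) (a1.prodMk a2.inv)
    refine ContMDiffAt.comp (y₀, extChartAt 𝓘(ℝ, EG) (u p) (u p)) ?_ a3
    refine contMDiffAt_extChartAt' ?_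
    simp only [hx, extChartAt_to_inv]
    rw [← s.invMap_eq hU]
    exact mem_chart_source _ _
  have key : ∀ {W : Opens M} (r : GaugeSection B W), B.proj p ∈ W →
      B.gfun r.sec p = u p →
      hat (E := EP) (E' := EP) p (s.invMap p) r.invMap =ᶠ[nhds y₀]
        fun y => F (y, hat (E := EP) (E' := EG) p (u p) (B.gfun r.sec) y) := by
    intro W r hW hr
    have sr : ContinuousAt (B.gfun r.sec) p :=
      (r.smooth.contMDiffAt ((isOpen_over W).mem_nhds hW)).continuousAt
    have c1 : ContinuousAt (extChartAt 𝓘(ℝ, EP) p).symm y₀ := continuousAt_extChartAt_symm p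
    have n1 := c1.eventually (by rw [hx]; exact (isOpen_over W).mem_nhds hW)
    have n2 := c1.eventually (p := fun q => B.gfun r.sec q ∈ (extChartAt 𝓘(ℝ, EG) (u p)).source)
      (by rw [hx]; exact sr.eventually (by rw [hr]; exact extChartAt_source_mem_nhds _))
    filter_upwards [n1, n2] with y hy1 hy2
    simp only [hat, F]
    rw [r.invMap_eq hy1, (extChartAt 𝓘(ℝ, EG) (u p)).left_inv hy2]
  have main := (hj.prodMk cu cv).comp cF (contDiffAt_id.prodMk cu) (contDiffAt_id.prodMk cv)
  have k1 := key s hU rfl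
  have k2 := key t hU' h0.symm
  refine ⟨?_, ?_, ?_⟩
  · rw [k1.self_of_nhds, k2.self_of_nhds]; exact main.1
  · rw [k1.fderiv_eq, k2.fderiv_eq]; exact main.2.1
  · rw [k1.fderiv.fderiv_eq, k2.fderiv.fderiv_eq]; exact main.2.2

lemma contDiffAt_formInChart [FiniteDimensional ℝ EP] {V : Opens M} (A : ConnSection B V) (q : P)
    {y : EP} (hy : y ∈ (extChartAt 𝓘(ℝ, EP) q).target)
    (hV : B.proj ((extChartAt 𝓘(ℝ, EP) q).symm y) ∈ V) :
    ContDiffAt ℝ ∞ (formInChart A.form q) y := by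
  set S : Set EP := (extChartAt 𝓘(ℝ, EP) q).target ∩
    (extChartAt 𝓘(ℝ, EP) q).symm ⁻¹' (B.proj ⁻¹' V) with hS
  have hSo : IsOpen S :=
    (contMDiffOn_extChartAt_symm (I := 𝓘(ℝ, EP)) (n := ∞) q).continuousOn.isOpen_inter_preimage
      (isOpen_extChartAt_target q) (isOpen_over V)
  suffices h : ContDiffOn ℝ ∞ (formInChart A.form q) S from h.contDiffAt (hSo.mem_nhds ⟨hy, hV⟩)
  rw [contDiffOn_clm_apply]
  intro v
  have h1 : ContMDiffOn 𝓘(ℝ, EP).tangent 𝓘(ℝ, EP).tangent ∞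
      (tangentMap 𝓘(ℝ, EP) 𝓘(ℝ, EP) (extChartAt 𝓘(ℝ, EP) q).symm) {w | w.proj ∈ S} := by
    refine (((contMDiffOn_extChartAt_symm (I := 𝓘(ℝ, EP)) (n := ∞) q).mono
      Set.inter_subset_left).contMDiffOn_tangentMapWithin (m := ∞) (s := S) (by simp)
        hSo.uniqueMDiffOn).congr ?_
    intro w hw
    rw [tangentMapWithin, tangentMap, mfderivWithin_of_isOpen hSo hw]
  have h2 : ContMDiffOn 𝓘(ℝ, EP) 𝓘(ℝ, EP).tangent ∞
      (fun z : EP => (⟨z, v⟩ : TangentBundle 𝓘(ℝ, EP) EP)) S :=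
    contMDiffOn_vectorSpace_iff_contDiffOn.2 contDiffOn_const
  have h3 := A.smooth.comp (h1.comp h2 (fun z hz => hz)) (fun z hz => hz.2)
  exact (contMDiffOn_iff_contDiffOn.1 h3)

lemma formInChart_pullback {U V : Opens M} (A : ConnSection B V) {φ : P → P}
    (h : IsLocalAut B U φ) (hUV : U ≤ V) {p : P} (hp : B.proj p ∈ U) :
    formInChart (A.pullback φ h hUV).form p =ᶠ[nhds (extChartAt 𝓘(ℝ, EP) p p)]
      fun y => (formInChart A.form (φ p) (hat (E := EP) (E' := EP) p (φ p) φ y)).comp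
        (fderiv ℝ (hat (E := EP) (E' := EP) p (φ p) φ) y) := by
  set y₀ := extChartAt 𝓘(ℝ, EP) p p with hy₀
  have hx : (extChartAt 𝓘(ℝ, EP) p).symm y₀ = p := extChartAt_to_inv p
  have c1 : ContinuousAt (extChartAt 𝓘(ℝ, EP) p).symm y₀ := continuousAt_extChartAt_symm p
  have hφ : ContinuousAt φ p := (h.mdiffAt hp).continuousAt
  have n1 : ∀ᶠ y in nhds y₀, B.proj ((extChartAt 𝓘(ℝ, EP) p).symm y) ∈ U :=
    c1.eventually (by rw [hx]; exact (isOpen_over U).mem_nhds hp)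
  have n2 : ∀ᶠ y in nhds y₀, φ ((extChartAt 𝓘(ℝ, EP) p).symm y) ∈
      (extChartAt 𝓘(ℝ, EP) (φ p)).source :=
    c1.eventually (p := fun q => φ q ∈ (extChartAt 𝓘(ℝ, EP) (φ p)).source)
      (by rw [hx]; exact hφ.eventually (extChartAt_source_mem_nhds _))
  have n3 : ∀ᶠ y in nhds y₀, y ∈ (extChartAt 𝓘(ℝ, EP) p).target :=
    (isOpen_extChartAt_target p).mem_nhds (mem_extChartAt_target p)
  filter_upwards [n1, n2, n3, n2.eventually_nhds] with y hy1 hy2 hy3 hy4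
  have hs : ContMDiffAt 𝓘(ℝ, EP) 𝓘(ℝ, EP) ∞ φ ((extChartAt 𝓘(ℝ, EP) p).symm y) :=
    h.smooth.contMDiffAt ((isOpen_over U).mem_nhds hy1)
  have d1 : MDifferentiableAt 𝓘(ℝ, EP) 𝓘(ℝ, EP) (extChartAt 𝓘(ℝ, EP) p).symm y :=
    (contMDiffAt_chart_symm p hy3).mdifferentiableAt (by simp)
  have e1 := tder_comp (g := φ) (f := (extChartAt 𝓘(ℝ, EP) p).symm) (h.mdiffAt hy1) d1
  have hy5 : hat (E := EP) (E' := EP) p (φ p) φ y ∈ (extChartAt 𝓘(ℝ, EP) (φ p)).target :=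
    (extChartAt 𝓘(ℝ, EP) (φ p)).map_source hy2
  have d2 : MDifferentiableAt 𝓘(ℝ, EP) 𝓘(ℝ, EP) (extChartAt 𝓘(ℝ, EP) (φ p)).symm
      (hat (E := EP) (E' := EP) p (φ p) φ y) :=
    (contMDiffAt_chart_symm (φ p) hy5).mdifferentiableAt (by simp)
  have d3 : MDifferentiableAt 𝓘(ℝ, EP) 𝓘(ℝ, EP) (hat (E := EP) (E' := EP) p (φ p) φ) y :=
    (contDiffAt_hat hy3 hs hy2).contMDiffAt.mdifferentiableAt (by simp)
  have e2 := tder_comp d2 d3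
  have e3 : (fun z => (extChartAt 𝓘(ℝ, EP) (φ p)).symm (hat (E := EP) (E' := EP) p (φ p) φ z))
      =ᶠ[nhds y] fun z => φ ((extChartAt 𝓘(ℝ, EP) p).symm z) := by
    filter_upwards [hy4] with z hz
    exact (extChartAt 𝓘(ℝ, EP) (φ p)).left_inv hz
  rw [formInChart, A.pullback_form φ h hUV hy1, ContinuousLinearMap.comp_assoc, ← e1,
    ← tder_congr e3, e2, tder_eq_fderiv, ← ContinuousLinearMap.comp_assoc, formInChart]
  congr 3
  exact ((extChartAt 𝓘(ℝ, EP) (φ p)).left_inv hy2).symm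

lemma pullback_jet [FiniteDimensional ℝ EP] {U U' V V' : Opens M} (A : ConnSection B V)
    (A' : ConnSection B V') {φ φ' : P → P} (h : IsLocalAut B U φ) (h' : IsLocalAut B U' φ')
    (hUV : U ≤ V) (hUV' : U' ≤ V') {p : P} (hp : B.proj p ∈ U) (hp' : B.proj p ∈ U')
    (e : φ p = φ' p) (hj : Jet2Eq (hat (E := EP) (E' := EP) p (φ p) φ) (hat p (φ p) φ')
      (extChartAt 𝓘(ℝ, EP) p p)) (hA : formJet1 A.form (φ p) = formJet1 A'.form (φ p)) :
    formJet1 (A.pullback φ h hUV).form p = formJet1 (A'.pullback φ' h' hUV').form p := by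
  set y₀ := extChartAt 𝓘(ℝ, EP) p p with hy₀
  have hy : y₀ ∈ (extChartAt 𝓘(ℝ, EP) p).target := mem_extChartAt_target p
  have hx : (extChartAt 𝓘(ℝ, EP) p).symm y₀ = p := extChartAt_to_inv p
  have k1 := formInChart_pullback A h hUV hp
  have k2 := formInChart_pullback A' h' hUV' hp'
  rw [← e] at k2
  have hz : hat (E := EP) (E' := EP) p (φ p) φ y₀ = extChartAt 𝓘(ℝ, EP) (φ p) (φ p) := by
    simp only [hat, hx]
  have hz' : hat (E := EP) (E' := EP) p (φ p) φ' y₀ = extChartAt 𝓘(ℝ, EP) (φ p) (φ p) := by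
    simp only [hat, hx, e]
  have c1 : ContDiffAt ℝ ∞ (hat (E := EP) (E' := EP) p (φ p) φ) y₀ :=
    contDiffAt_hat hy
      (by rw [hx]; exact h.smooth.contMDiffAt ((isOpen_over U).mem_nhds hp))
      (by rw [hx]; exact mem_extChartAt_source _)
  have c2 : ContDiffAt ℝ ∞ (hat (E := EP) (E' := EP) p (φ p) φ') y₀ :=
    contDiffAt_hat hy
      (by rw [hx]; exact h'.smooth.contMDiffAt ((isOpen_over U').mem_nhds hp'))
      (by rw [hx, e]; exact mem_extChartAt_source _)
  have der : ∀ {W : Opens M} (C : ConnSection B W) {f : EP → EP}, B.proj (φ p) ∈ W →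
      f y₀ = extChartAt 𝓘(ℝ, EP) (φ p) (φ p) → ContDiffAt ℝ ∞ f y₀ →
      fderiv ℝ (fun y => (formInChart C.form (φ p) (f y)).comp (fderiv ℝ f y)) y₀ =
        (ContinuousLinearMap.compL ℝ EP EP EG
          (formInChart C.form (φ p) (extChartAt 𝓘(ℝ, EP) (φ p) (φ p)))).comp
            (fderiv ℝ (fderiv ℝ f) y₀)
        + ((ContinuousLinearMap.compL ℝ EP EP EG).flip (fderiv ℝ f y₀)).comp
          ((fderiv ℝ (formInChart C.form (φ p)) (extChartAt 𝓘(ℝ, EP) (φ p) (φ p))).comp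
            (fderiv ℝ f y₀)) := by
    intro W C f hW hf cf
    have hC : DifferentiableAt ℝ (formInChart C.form (φ p)) (f y₀) := by
      rw [hf]
      exact (contDiffAt_formInChart C (φ p) (mem_extChartAt_target _)
        (by rwa [extChartAt_to_inv])).differentiableAt (by simp)
    have := HasFDerivAt.clm_comp
      (HasFDerivAt.comp y₀ hC.hasFDerivAt (cf.differentiableAt (by simp)).hasFDerivAt)
      ((contDiffAt_fderiv cf).differentiableAt (by simp)).hasFDerivAt
    rw [Function.comp_apply, hf] at this
    exact this.fderiv
  simp only [formJet1, Prod.mk.injEq] at hA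
  have hφ : B.proj (φ p) = B.proj p := h.proj_eq p hp
  refine Prod.ext ?_ ?_
  · change formInChart _ p y₀ = formInChart _ p y₀
    rw [k1.self_of_nhds, k2.self_of_nhds]
    simp only [← hy₀, hz, hz', hA.1, hj.2.1]
  · change fderiv ℝ (formInChart _ p) y₀ = fderiv ℝ (formInChart _ p) y₀
    rw [k1.fderiv_eq, k2.fderiv_eq, der A (by rw [hφ]; exact hUV hp) hz c1,
      der A' (by rw [hφ]; exact hUV' hp') hz' c2, hA.1, hA.2, hj.2.1, hj.2.2]

lemma IsLocalAut.mono {U V : Opens M} {φ : P → P} (h : IsLocalAut B V φ) (hUV : U ≤ V) :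
    IsLocalAut B U φ where
  smooth := h.smooth.mono fun _ hp => hUV hp
  proj_eq p hp := h.proj_eq p (hUV hp)
  act_eq p g hp := h.act_eq p g (hUV hp)

/-- The action of local sections of `P ×_G G` on local sections of `CP` around `m`: the
transformation of `P` defined by `s` moves connection forms by pull-back under its inverse. -/
def localAct {m : M} (s : LocalGauge B m) (A : LocalConn B m) : LocalConn B m :=
  ⟨⟨s.1.1 ⊓ A.1.1, s.1.2, A.1.2⟩,
    A.2.pullback s.2.invMap (s.2.isLocalAut.mono inf_le_left) inf_le_right⟩

/-- The action of `J²(P ×_G G)` on `J(CP)`: act on local sections, then take jets. -/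
def j2Act [FiniteDimensional ℝ EP] {m : M} (a : J2Gauge B m) (j : JConn B m) : JConn B m :=
  Quotient.map₂ localAct
    (by
      intro s t hst A A' hA p hp
      have hs : B.proj p ∈ s.1.1 := hp ▸ s.1.2
      have ht : B.proj p ∈ t.1.1 := hp ▸ t.1.2
      have hA1 : B.proj p ∈ A.1.1 := hp ▸ A.1.2
      have hA2 : B.proj p ∈ A'.1.1 := hp ▸ A'.1.2
      obtain ⟨h0, h1⟩ := invMap_jet s.2 t.2 hs ht (hst p hp)
      exact pullback_jet A.2 A'.2 (s.2.isLocalAut.mono inf_le_left)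
        (t.2.isLocalAut.mono inf_le_left) inf_le_right inf_le_right ⟨hs, hA1⟩ ⟨ht, hA2⟩ h0 h1
        (hA _ ((s.2.isLocalAut.proj_eq p hs).trans hp))) a j

variable (B)

/-- The group `Gau(P)`: strict automorphisms of `P`, i.e. `G`-equivariant diffeomorphisms of `P`
over the identity of `M`. -/
structure Gau where
  toDiffeomorph : Diffeomorph 𝓘(ℝ, EP) 𝓘(ℝ, EP) P P ∞
  proj_eq : ∀ p, B.proj (toDiffeomorph p) = B.proj p
  act_eq : ∀ p g, toDiffeomorph (B.act p g) = B.act (toDiffeomorph p) g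

variable {B}

lemma Gau.isLocalAut_symm (f : Gau B) : IsLocalAut B ⊤ f.toDiffeomorph.symm where
  smooth := f.toDiffeomorph.symm.contMDiff.contMDiffOn
  proj_eq p _ := by
    rw [← f.proj_eq, Diffeomorph.apply_symm_apply]
  act_eq p g _ := by
    have h := f.act_eq (f.toDiffeomorph.symm p) g
    rw [Diffeomorph.apply_symm_apply] at h
    rw [← h, Diffeomorph.symm_apply_apply]

/-- The action of `Gau(P)` on `Γ(CP)`: `f · A = (f⁻¹)^* A`. -/
def Gau.act (f : Gau B) (A : ConnSection B ⊤) : ConnSection B ⊤ :=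
  A.pullback f.toDiffeomorph.symm f.isLocalAut_symm le_rfl

/-- The 1-jet at `m` of a local section of `CP`. -/
def jetMk {m : M} (A : LocalConn B m) : JConn B m := Quotient.mk (jet1Setoid B m) A

/-- The 1-jet at `m` of a global section of `CP`. -/
def ConnSection.jet (A : ConnSection B ⊤) (m : M) : JConn B m := jetMk ⟨⟨⊤, Opens.mem_top m⟩, A⟩

/-! ### Lagrangians and action functionals -/

/-- The coefficient of the `n`-form `α` at `x` with respect to `dx¹ ∧ ⋯ ∧ dxⁿ` in the
preferred chart at `x₀`. -/
def coeff (x₀ x : M) (α : TangentSpace (𝓡 n) x [⋀^Fin n]→L[ℝ] ℝ) : ℝ :=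
  α fun i => tder (𝓡 n) (𝓡 n) (extChartAt (𝓡 n) x₀).symm (extChartAt (𝓡 n) x₀ x)
    (EuclideanSpace.single i (1 : ℝ))

/-- The `𝔤`-valued 1-form `σ^* A` (the gauge potential) in the preferred chart of `M` at `x₀`. -/
def potential (x₀ : M) (σ : M → P) (A : P → (EP →L[ℝ] EG)) (y : EuclideanSpace ℝ (Fin n)) :
    EuclideanSpace ℝ (Fin n) →L[ℝ] EG :=
  (A (σ ((extChartAt (𝓡 n) x₀).symm y))).comp
    (tder (𝓡 n) 𝓘(ℝ, EP) (fun z => σ ((extChartAt (𝓡 n) x₀).symm z)) y)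

variable (B) in
/-- A smooth gauge field Lagrangian `J(CP) → ⋀ⁿ T^*M`, a bundle map over `M`. Smoothness is
smoothness in the coordinates `(x, A_μ, ∂_μ A_ν)` of `J(CP)` that are induced by a chart of `M`
and a local section `σ` of `P` around each point. -/
structure GaugeLagrangian where
  toFun : ∀ m : M, JConn B m → TangentSpace (𝓡 n) m [⋀^Fin n]→L[ℝ] ℝ
  smooth : ∀ x₀ : M, ∃ (U : Opens M) (σ : M → P)
    (ℓ : EuclideanSpace ℝ (Fin n) × (EuclideanSpace ℝ (Fin n) →L[ℝ] EG) ×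
      (EuclideanSpace ℝ (Fin n) →L[ℝ] EuclideanSpace ℝ (Fin n) →L[ℝ] EG) → ℝ),
    x₀ ∈ U ∧ (U : Set M) ⊆ (extChartAt (𝓡 n) x₀).source ∧ B.IsSectionOn σ U ∧
    ContDiffOn ℝ ∞ ℓ ((extChartAt (𝓡 n) x₀ '' U) ×ˢ Set.univ) ∧
    ∀ x ∈ U, ∀ A : LocalConn B x,
      coeff x₀ x (toFun x (jetMk A)) =
        ℓ (extChartAt (𝓡 n) x₀ x, potential x₀ σ A.2.form (extChartAt (𝓡 n) x₀ x),
          fderiv ℝ (potential x₀ σ A.2.form) (extChartAt (𝓡 n) x₀ x))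

section Integral

variable [IsManifold (𝓡 n) ∞ M] [T2Space M] [SigmaCompactSpace M]

variable (n M) in
/-- A smooth partition of unity subordinate to the preferred charts of `M`. -/
def chartPartition : SmoothPartitionOfUnity M (𝓡 n) M Set.univ :=
  Classical.choose (SmoothPartitionOfUnity.exists_isSubordinate_chartAt_source (𝓡 n) M)

/-- The integral over the compact set `K` of a continuous `n`-form `α` on `M`, oriented by its
atlas. -/
def formIntegral (α : ∀ x : M, TangentSpace (𝓡 n) x [⋀^Fin n]→L[ℝ] ℝ) (K : Set M) : ℝ :=
  ∑ᶠ i : M, ∫ y in (extChartAt (𝓡 n) i).target ∩ (extChartAt (𝓡 n) i).symm ⁻¹' K,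
    chartPartition n M i ((extChartAt (𝓡 n) i).symm y) *
      coeff i ((extChartAt (𝓡 n) i).symm y) (α ((extChartAt (𝓡 n) i).symm y))

namespace GaugeLagrangian

/-- The action functional `S_K[A] = ∫_K L(A, ∂A)`. -/
def action (L : GaugeLagrangian B) (K : Set M) (A : ConnSection B ⊤) : ℝ :=
  formIntegral (fun m => L.toFun m (A.jet m)) K

/-- The action functionals over all compact sets are `Gau(P)`-invariant. -/
def IsGaugeInvariant (L : GaugeLagrangian B) : Prop :=
  ∀ K : Set M, IsCompact K → ∀ (f : Gau B) (A : ConnSection B ⊤),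
    L.action K (f.act A) = L.action K A

/-- `L` is invariant under the action of `J²(P ×_G G)` on `J(CP)`. -/
def IsJ2Invariant [FiniteDimensional ℝ EP] (L : GaugeLagrangian B) : Prop :=
  ∀ (m : M) (a : J2Gauge B m) (j : JConn B m), L.toFun m (j2Act a j) = L.toFun m j

end GaugeLagrangian
end Integral

end Main
end GaugeField
end

/-! A gauge transformation `f` amounts to an equivariant function `u : P → G` with `f p = p · u p`,
that is, to a global section of `P ×_G G`. Its effect on the 1-jet of a connection at `m` is
therefore the action of a 2-jet (`jet_act_eq_j2Act`, `jet_act_exists_j2`). Hence J²-invariance makes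
the densities of `A` and `f · A` equal at every point, and their integrals agree, with no condition
on `G` or `P`.

For the converse, the integrals over all compact sets determine a continuous `n`-form on an oriented
manifold (`eq_of_formIntegral_eq`), so gauge invariance yields pointwise equality of the densities
of `A` and `f · A` for global `A` and `f`. It remains to realise all jets by global data.

Germs of connections extend because connections can be averaged by a partition of unity, the
complementary pieces being flat connections of local trivializations (`exists_connSection_eq_near`).
For gauge germs the obstruction is the value in `G`: a germ whose value at `m` is close to 1 can be
cut off in a chart of `G` at 1 (`IsLocalTriv.exists_isGaugeFun_of_near_one`), and a general germ is
reduced to this case by dividing by a global transformation with the same value over `m`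
(`exists_gau_eq_near`). Such a transformation exists if `P` is trivial, through constant functions,
and if `G` is connected, because the attainable values form an open subgroup
(`exists_isGaugeFun_apply_eq`). -/

noncomputable section

set_option linter.unusedSectionVars false

namespace GaugeField

open PrincipalBundle TopologicalSpace Filter MeasureTheory

/-! ### Gauge transformations as equivariant functions, and their action on jets -/

section Gauge

variable {n : ℕ} {EG EP M G P : Type*}
  [NormedAddCommGroup EG] [NormedSpace ℝ EG] [NormedAddCommGroup EP] [NormedSpace ℝ EP]
  [TopologicalSpace M] [ChartedSpace (EuclideanSpace ℝ (Fin n)) M]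
  [TopologicalSpace G] [ChartedSpace EG G] [Group G]
  [TopologicalSpace P] [ChartedSpace EP P]
  {B : PrincipalBundle n EG EP M G P}

variable (B) in
/-- A local trivialization of `P` over the open set `U`: a section `σ` together with the
`G`-valued coordinate `τ`, so that `p = σ (proj p) · τ p`. -/
structure IsLocalTriv (U : Opens M) (σ : M → P) (τ : P → G) : Prop where
  section_smooth : ContMDiffOn (𝓡 n) 𝓘(ℝ, EP) ∞ σ U
  proj_section : ∀ x ∈ U, B.proj (σ x) = x
  coord_smooth : ContMDiffOn 𝓘(ℝ, EP) 𝓘(ℝ, EG) ∞ τ (B.proj ⁻¹' U)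
  section_act_coord : ∀ p, B.proj p ∈ U → B.act (σ (B.proj p)) (τ p) = p
  coord_section_act : ∀ x ∈ U, ∀ g, τ (B.act (σ x) g) = g

variable (B) in
lemma exists_isLocalTriv (m : M) : ∃ (U : Opens M) (σ : M → P) (τ : P → G),
    m ∈ U ∧ IsLocalTriv B U σ τ := by
  obtain ⟨U, hU, hm, σ, τ, h1, h2, h3, h4, h5⟩ := B.locallyTrivial m
  exact ⟨⟨U, hU⟩, σ, τ, hm, h1, h2, h3, h4, h5⟩

variable (B) in
lemma proj_surjective (m : M) : ∃ p, B.proj p = m := by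
  obtain ⟨U, σ, τ, hm, h⟩ := exists_isLocalTriv B m
  exact ⟨σ m, h.proj_section m hm⟩

namespace IsLocalTriv

variable {U : Opens M} {σ : M → P} {τ : P → G}

lemma coord_act (h : IsLocalTriv B U σ τ) {p : P} (hp : B.proj p ∈ U) (g : G) :
    τ (B.act p g) = τ p * g := by
  conv_lhs => rw [← h.section_act_coord p hp, B.act_mul]
  exact h.coord_section_act _ hp _

end IsLocalTriv

variable [LieGroup 𝓘(ℝ, EG) ∞ G] [IsManifold 𝓘(ℝ, EP) ∞ P]

/-- The "difference" of two points in a fibre depends smoothly on them: in a local trivialization it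
is `(τ a)⁻¹ * τ b`. -/
lemma contMDiffAt_translation {E H N : Type*} [NormedAddCommGroup E] [NormedSpace ℝ E]
    [TopologicalSpace H] {I : ModelWithCorners ℝ E H} [TopologicalSpace N] [ChartedSpace H N]
    {a b : N → P} {d : N → G} {x : N} (ha : ContMDiffAt I 𝓘(ℝ, EP) ∞ a x)
    (hb : ContMDiffAt I 𝓘(ℝ, EP) ∞ b x) (h : ∀ᶠ y in nhds x, B.act (a y) (d y) = b y) :
    ContMDiffAt I 𝓘(ℝ, EG) ∞ d x := by
  obtain ⟨U, σ, τ, hm, hU⟩ := exists_isLocalTriv B (B.proj (a x))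
  have hτ : ∀ {c : N → P}, ContMDiffAt I 𝓘(ℝ, EP) ∞ c x → B.proj (c x) ∈ U →
      ContMDiffAt I 𝓘(ℝ, EG) ∞ (fun y => τ (c y)) x := fun hc hcU =>
    ContMDiffAt.comp x (hU.coord_smooth.contMDiffAt ((isOpen_over U).mem_nhds hcU)) hc
  have hbU : B.proj (b x) ∈ U := by rwa [← h.self_of_nhds, B.proj_act]
  refine ((hτ ha hm).inv.mul (hτ hb hbU)).congr_of_eventuallyEq ?_
  filter_upwards [h, ha.continuousAt.eventually ((isOpen_over U).mem_nhds hm)] with y hy hy'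
  change d y = (τ (a y))⁻¹ * τ (b y)
  rw [← hy, hU.coord_act hy', inv_mul_cancel_left]

variable (B) in
/-- `u : P → G` is smooth and equivariant, i.e. it represents a global section of `P ×_G G`. -/
structure IsGaugeFun (u : P → G) : Prop where
  smooth : ContMDiff 𝓘(ℝ, EP) 𝓘(ℝ, EG) ∞ u
  apply_act : ∀ p g, u (B.act p g) = g⁻¹ * u p * g

namespace IsGaugeFun

lemma one : IsGaugeFun B (fun _ => (1 : G)) where
  smooth := contMDiff_const
  apply_act p g := by simp

lemma mul {u v : P → G} (hu : IsGaugeFun B u) (hv : IsGaugeFun B v) :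
    IsGaugeFun B (fun p => u p * v p) where
  smooth := hu.smooth.mul hv.smooth
  apply_act p g := by rw [hu.apply_act, hv.apply_act]; group

lemma inv {u : P → G} (hu : IsGaugeFun B u) : IsGaugeFun B (fun p => (u p)⁻¹) where
  smooth := hu.smooth.inv
  apply_act p g := by rw [hu.apply_act]; group

/-- The automorphism `p ↦ p · u p` of `P`. -/
def toGau {u : P → G} (hu : IsGaugeFun B u) : Gau B where
  toDiffeomorph :=
    { toFun := fun p => B.act p (u p)
      invFun := fun p => B.act p (u p)⁻¹
      left_inv := fun p => by
        change B.act (B.act p (u p)) (u (B.act p (u p)))⁻¹ = p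
        rw [hu.apply_act, B.act_mul]
        convert B.act_one p using 2
        group
      right_inv := fun p => by
        change B.act (B.act p (u p)⁻¹) (u (B.act p (u p)⁻¹)) = p
        rw [hu.apply_act, B.act_mul]
        convert B.act_one p using 2
        group
      contMDiff_toFun := B.contMDiff_act.comp (contMDiff_id.prodMk hu.smooth)
      contMDiff_invFun := B.contMDiff_act.comp (contMDiff_id.prodMk hu.smooth.inv) }
  proj_eq p := B.proj_act _ _
  act_eq p g := by
    change B.act (B.act p g) (u (B.act p g)) = B.act (B.act p (u p)) g
    rw [hu.apply_act, B.act_mul, B.act_mul]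
    congr 1
    group

lemma toGau_symm_apply {u : P → G} (hu : IsGaugeFun B u) (p : P) :
    hu.toGau.toDiffeomorph.symm p = B.act p (u p)⁻¹ := rfl

/-- Every equivariant function represents a global section of `P ×_G G`. -/
lemma exists_gaugeSection {u : P → G} (hu : IsGaugeFun B u) :
    ∃ s : GaugeSection B ⊤, B.gfun s.sec = u := by
  choose r hr using proj_surjective B
  have h : B.gfun (fun x => B.gmk (r x) (u (r x))) = u := by
    funext p
    obtain ⟨g, hg⟩ := act_transitive (B := B) (hr (B.proj p))
    have : B.gmk (r (B.proj p)) (u (r (B.proj p))) = B.gmk p (u p) := by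
      -- Naming the reference point `q` protects the `p` inside `r (B.proj p)` from the rewriting of
      -- `p` as `q · g`.
      obtain ⟨q, hq⟩ : ∃ q, q = r (B.proj p) := ⟨_, rfl⟩
      rw [← hq] at hg ⊢
      rw [← hg, B.gmk_act, hu.apply_act]
      congr 1
      group
    rw [gfun, this, gcoord_gmk]
  exact ⟨⟨fun x => B.gmk (r x) (u (r x)), fun x _ => hr x, by
    rw [h]; exact hu.smooth.contMDiffOn⟩, h⟩

end IsGaugeFun

lemma GaugeSection.gfun_act {U : Opens M} (s : GaugeSection B U) {p : P} (hp : B.proj p ∈ U)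
    (g : G) : B.gfun s.sec (B.act p g) = g⁻¹ * B.gfun s.sec p * g := by
  rw [gfun, B.proj_act, gcoord_act (s.gproj_sec _ hp)]
  rfl

/-- Transitivity on fibres produces `u`, freeness makes it equivariant, and smoothness is that of
the fibrewise difference of `p` and `f p`. -/
lemma Gau.exists_isGaugeFun (f : Gau B) :
    ∃ u : P → G, IsGaugeFun B u ∧ ∀ p, f.toDiffeomorph p = B.act p (u p) := by
  choose u hu using fun p => act_transitive (B := B) (f.proj_eq p).symm
  refine ⟨u, ⟨fun p => contMDiffAt_translation contMDiffAt_id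
    f.toDiffeomorph.contMDiff.contMDiffAt (Eventually.of_forall hu), fun p g => ?_⟩,
    fun p => (hu p).symm⟩
  have h := f.act_eq p g
  rw [← hu, ← hu p, B.act_mul, B.act_mul] at h
  have := act_free h
  rw [mul_assoc, ← this]
  group

lemma jetMk_congr {m : M} {A A' : LocalConn B m}
    (h : ∀ᶠ x in nhds m, ∀ p, B.proj p = x → A.2.form p = A'.2.form p) :
    jetMk A = jetMk A' := by
  refine Quotient.sound fun p hp => ?_
  have hx : (extChartAt 𝓘(ℝ, EP) p).symm (extChartAt 𝓘(ℝ, EP) p p) = p := extChartAt_to_inv p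
  have c : ContinuousAt (fun y => B.proj ((extChartAt 𝓘(ℝ, EP) p).symm y))
      (extChartAt 𝓘(ℝ, EP) p p) :=
    ContinuousAt.comp (g := B.proj) (by rw [hx]; exact B.contMDiff_proj.continuous.continuousAt)
      (continuousAt_extChartAt_symm p)
  have key : formInChart A.2.form p =ᶠ[nhds (extChartAt 𝓘(ℝ, EP) p p)]
      formInChart A'.2.form p := by
    have hm : B.proj ((extChartAt 𝓘(ℝ, EP) p).symm (extChartAt 𝓘(ℝ, EP) p p)) = m := by
      rw [hx, hp]
    have h' := (show Tendsto _ _ (nhds m) from hm ▸ c.tendsto).eventually h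
    filter_upwards [h'] with y hy
    rw [formInChart, formInChart, hy _ rfl]
  exact Prod.ext key.self_of_nhds key.fderiv_eq

variable [FiniteDimensional ℝ EP]

/-- If `f⁻¹` is the inverse transformation of the local gauge section `s` near the fibre over `m`,
then `f` acts on 1-jets at `m` as the 2-jet of `s`. -/
lemma jet_act_eq_j2Act {m : M} (s : LocalGauge B m) (f : Gau B)
    (h : ∀ᶠ x in nhds m, ∀ p, B.proj p = x → f.toDiffeomorph.symm p = s.2.invMap p)
    (A : ConnSection B ⊤) :
    (f.act A).jet m = j2Act (Quotient.mk (jet2Setoid B m) s) (A.jet m) := by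
  refine jetMk_congr (A' := localAct s _) ?_
  -- Pull-back involves the tangent map, so the two maps must agree on a neighbourhood of each
  -- nearby fibre, not only along it.
  filter_upwards [h.eventually_nhds, s.1.1.isOpen.mem_nhds s.1.2] with x hx hxU p hp
  have hp' : B.proj p ∈ s.1.1 ⊓ (⊤ : Opens M) := ⟨hp ▸ hxU, trivial⟩
  change (A.pullback _ f.isLocalAut_symm le_rfl).form p =
    (A.pullback _ (s.2.isLocalAut.mono inf_le_left) inf_le_right).form p
  rw [ConnSection.pullback_form _ _ _ _ (Opens.mem_top _), ConnSection.pullback_form _ _ _ _ hp']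
  have e : (f.toDiffeomorph.symm : P → P) =ᶠ[nhds p] s.2.invMap := by
    subst hp
    filter_upwards [B.contMDiff_proj.continuous.continuousAt.eventually hx] with q hq
    exact hq q rfl
  rw [tder_congr e, e.self_of_nhds]

lemma jet_act_exists_j2 (f : Gau B) (A : ConnSection B ⊤) (m : M) :
    ∃ a : J2Gauge B m, (f.act A).jet m = j2Act a (A.jet m) := by
  obtain ⟨u, hu, hf⟩ := f.exists_isGaugeFun
  obtain ⟨s, hs⟩ := hu.exists_gaugeSection
  refine ⟨_, jet_act_eq_j2Act ⟨⟨⊤, Opens.mem_top m⟩, s⟩ f (Eventually.of_forall fun x p _ => ?_) A⟩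
  rw [s.invMap_eq (Opens.mem_top _), hs, ← hu.toGau_symm_apply]
  apply f.toDiffeomorph.injective
  change f.toDiffeomorph _ = f.toDiffeomorph _
  rw [Diffeomorph.apply_symm_apply, hf]
  exact (hu.toGau.toDiffeomorph.apply_symm_apply p).symm

end Gauge

/-! ### Extending local gauge transformations to global ones -/

/-- A map with values in a convex coordinate ball around `o` extends from a neighbourhood of `m`
to a global map that is constantly `o` off a closed subset of a given open set. -/
lemma exists_contMDiff_extension {E F M N : Type*} [NormedAddCommGroup E] [NormedSpace ℝ E]
    [FiniteDimensional ℝ E] {H : Type*} [TopologicalSpace H] {I : ModelWithCorners ℝ E H}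
    [TopologicalSpace M] [ChartedSpace H M] [IsManifold I ∞ M] [T2Space M]
    [NormedAddCommGroup F] [NormedSpace ℝ F]
    [TopologicalSpace N] [ChartedSpace F N] [IsManifold 𝓘(ℝ, F) ∞ N] (o : N) {r : ℝ}
    (hr : Metric.ball (extChartAt 𝓘(ℝ, F) o o) r ⊆ (extChartAt 𝓘(ℝ, F) o).target)
    {v : M → N} {W : Set M} (hW : IsOpen W) {m : M} (hm : m ∈ W)
    (hv : ContMDiffOn I 𝓘(ℝ, F) ∞ v W)
    (hvN : ∀ x ∈ W, v x ∈ (extChartAt 𝓘(ℝ, F) o).source ∧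
      extChartAt 𝓘(ℝ, F) o (v x) ∈ Metric.ball (extChartAt 𝓘(ℝ, F) o o) r) :
    ∃ h : M → N, ContMDiff I 𝓘(ℝ, F) ∞ h ∧ h =ᶠ[nhds m] v ∧
      ∃ C : Set M, IsClosed C ∧ C ⊆ W ∧ ∀ x ∉ C, h x = o := by
  obtain ⟨χ, -, hχ⟩ := (SmoothBumpFunction.nhds_basis_tsupport (I := I) m).mem_iff.1
    (hW.mem_nhds hm)
  set κ := extChartAt 𝓘(ℝ, F) o with hκ
  have hχ0 : ∀ x ∉ tsupport χ, χ x = 0 := fun x hx =>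
    Function.notMem_support.1 fun h => hx (subset_tsupport _ h)
  -- Straight-line interpolation in the chart between `o` (where `χ = 0`) and `v` (where `χ = 1`).
  -- The segment stays in the ball since `0 ≤ χ ≤ 1`.
  let h : M → N := fun x => κ.symm (κ o + χ x • (κ (v x) - κ o))
  have hoff : ∀ x ∉ tsupport χ, h x = o := fun x hx => by
    simp only [h, hχ0 x hx, zero_smul, add_zero]
    exact extChartAt_to_inv o
  refine ⟨h, fun x => ?_, ?_, tsupport χ, isClosed_tsupport _, hχ, hoff⟩
  · by_cases hx : x ∈ W
    · have h0 : κ o + χ x • (κ (v x) - κ o) ∈ κ.target := by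
        refine hr ?_
        have h1 := (hvN x hx).2
        rw [Metric.mem_ball, dist_eq_norm] at h1 ⊢
        rw [add_sub_cancel_left, norm_smul, Real.norm_of_nonneg χ.nonneg]
        exact (mul_le_of_le_one_left (norm_nonneg _) χ.le_one).trans_lt h1
      have h1 : ContMDiffAt I 𝓘(ℝ, F) ∞ (fun x => κ (v x)) x :=
        (contMDiffAt_extChartAt' (by rw [← extChartAt_source 𝓘(ℝ, F)]; exact (hvN x hx).1)).comp x
          (hv.contMDiffAt (hW.mem_nhds hx))
      exact (contMDiffAt_chart_symm o h0).comp x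
        (contMDiffAt_const.add (χ.contMDiff.contMDiffAt.smul (h1.sub contMDiffAt_const)))
    · have hx' : x ∉ tsupport χ := fun h' => hx (hχ h')
      refine (contMDiffAt_const (c := o)).congr_of_eventuallyEq ?_
      filter_upwards [(isClosed_tsupport χ).isOpen_compl.mem_nhds hx'] with y hy
      exact hoff y hy
  · filter_upwards [χ.eventuallyEq_one, hW.mem_nhds hm] with x hx hxW
    simp only [h, hx, Pi.one_apply, one_smul, add_sub_cancel]
    exact κ.left_inv (hvN x hxW).1

section Gauge

variable {n : ℕ} {EG EP M G P : Type*}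
  [NormedAddCommGroup EG] [NormedSpace ℝ EG] [NormedAddCommGroup EP] [NormedSpace ℝ EP]
  [TopologicalSpace M] [ChartedSpace (EuclideanSpace ℝ (Fin n)) M]
  [TopologicalSpace G] [ChartedSpace EG G] [Group G]
  [TopologicalSpace P] [ChartedSpace EP P]
  {B : PrincipalBundle n EG EP M G P}
  [LieGroup 𝓘(ℝ, EG) ∞ G] [IsManifold 𝓘(ℝ, EP) ∞ P]

/-- Conjugation by `τ` turns functions on the base into equivariant ones. Extension by 1 is smooth
because `U` and the complement of `C` are open and cover `M`. -/
lemma IsLocalTriv.exists_isGaugeFun {U : Opens M} {σ : M → P} {τ : P → G}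
    (hU : IsLocalTriv B U σ τ) {h : M → G} (hh : ContMDiff (𝓡 n) 𝓘(ℝ, EG) ∞ h) {C : Set M}
    (hC : IsClosed C) (hCU : C ⊆ U) (h1 : ∀ x ∉ C, h x = 1) :
    ∃ u, IsGaugeFun B u ∧ ∀ p, B.proj p ∈ U → u p = (τ p)⁻¹ * h (B.proj p) * τ p := by
  classical
  let u : P → G := fun p => if B.proj p ∈ U then (τ p)⁻¹ * h (B.proj p) * τ p else 1
  have hu : ∀ p, B.proj p ∈ U → u p = (τ p)⁻¹ * h (B.proj p) * τ p := fun p hp => if_pos hp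
  have hu1 : ∀ p, B.proj p ∉ C → u p = 1 := fun p hp => by
    by_cases hpU : B.proj p ∈ U
    · simp [hu p hpU, h1 _ hp]
    · exact if_neg hpU
  refine ⟨u, ⟨fun p => ?_, fun p g => ?_⟩, hu⟩
  · by_cases hp : B.proj p ∈ U
    · have ht := hU.coord_smooth.contMDiffAt ((isOpen_over U).mem_nhds hp)
      have hhp : ContMDiffAt 𝓘(ℝ, EP) 𝓘(ℝ, EG) ∞ (fun p => h (B.proj p)) p :=
        (hh.comp B.contMDiff_proj).contMDiffAt
      refine ((ht.inv.mul hhp).mul ht).congr_of_eventuallyEq ?_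
      filter_upwards [(isOpen_over U).mem_nhds hp] with q hq
      exact hu q hq
    · have hpC : B.proj p ∉ C := fun h' => hp (hCU h')
      refine (contMDiffAt_const (c := (1 : G))).congr_of_eventuallyEq ?_
      filter_upwards [(hC.isOpen_compl.preimage B.contMDiff_proj.continuous).mem_nhds hpC]
        with q hq
      exact hu1 q hq
  · by_cases hp : B.proj p ∈ U
    · rw [hu p hp, hu _ (by rwa [B.proj_act]), B.proj_act, hU.coord_act hp]
      group
    · have hpC : B.proj p ∉ C := fun h' => hp (hCU h')
      rw [hu1 p hpC, hu1 _ (by rwa [B.proj_act])]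
      simp

variable [IsManifold (𝓡 n) ∞ M] [T2Space M]

/-- `N` is the preimage of a coordinate ball centred at 1. Near `m` the values of `v` stay in it by
continuity, so `v` can be cut off to the constant 1 inside the chart domain. -/
lemma IsLocalTriv.exists_isGaugeFun_of_near_one {U : Opens M} {σ : M → P} {τ : P → G}
    (hU : IsLocalTriv B U σ τ) {m : M} (hm : m ∈ U) : ∃ N : Set G, IsOpen N ∧ 1 ∈ N ∧
      ∀ v : M → G, (∀ᶠ x in nhds m, ContMDiffAt (𝓡 n) 𝓘(ℝ, EG) ∞ v x) → v m ∈ N →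
        ∃ u, IsGaugeFun B u ∧
          ∀ᶠ x in nhds m, ∀ p, B.proj p = x → u p = (τ p)⁻¹ * v x * τ p := by
  have : IsManifold 𝓘(ℝ, EG) ∞ G := inferInstance
  obtain ⟨r, hr, hball⟩ := Metric.isOpen_iff.1 (isOpen_extChartAt_target (I := 𝓘(ℝ, EG)) (1 : G))
    _ (mem_extChartAt_target 1)
  set κ := extChartAt 𝓘(ℝ, EG) (1 : G)
  have hN : IsOpen (κ.source ∩ κ ⁻¹' Metric.ball (κ 1) r) :=
    (continuousOn_extChartAt (I := 𝓘(ℝ, EG)) (1 : G)).isOpen_inter_preimage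
      (isOpen_extChartAt_source 1) Metric.isOpen_ball
  refine ⟨_, hN, ⟨mem_extChartAt_source _, Metric.mem_ball_self hr⟩, fun v hv hvm => ?_⟩
  obtain ⟨W, hW, hWo, hmW⟩ := eventually_nhds_iff.1 ((hv.and (hv.self_of_nhds.continuousAt.eventually
    (hN.mem_nhds hvm))).and (U.isOpen.mem_nhds hm))
  obtain ⟨h, hh, hhv, C, hC, hCW, hC1⟩ := exists_contMDiff_extension (I := 𝓡 n) (1 : G) hball
    hWo hmW (fun x hx => (hW x hx).1.1.contMDiffWithinAt) (fun x hx => (hW x hx).1.2)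
  obtain ⟨u, hu, hu'⟩ := hU.exists_isGaugeFun hh hC (fun x hx => (hW x (hCW hx)).2) hC1
  refine ⟨u, hu, ?_⟩
  filter_upwards [hhv, U.isOpen.mem_nhds hm] with x hx hxU p hp
  subst hp
  rw [hu' p hxU, hx]

/-- For connected `G` the values at `p` form a subgroup containing a neighbourhood of 1, hence an
open and closed one. For trivial `P` a constant function on the base, conjugated by the global
coordinate `τ`, takes any prescribed value. -/
lemma exists_isGaugeFun_apply_eq
    (hGP : ConnectedSpace G ∨ ∃ σ : M → P, B.IsSectionOn σ Set.univ) (p : P) (g : G) :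
    ∃ u, IsGaugeFun B u ∧ u p = g := by
  rcases hGP with hG | ⟨σ, hσ, hσ'⟩
  · have : IsTopologicalGroup G := topologicalGroup_of_lieGroup 𝓘(ℝ, EG) ∞
    obtain ⟨U, σ, τ, hm, hU⟩ := exists_isLocalTriv B (B.proj p)
    obtain ⟨N, hN, h1N, h⟩ := hU.exists_isGaugeFun_of_near_one hm
    let S : Subgroup G :=
      { carrier := {g | ∃ u, IsGaugeFun B u ∧ u p = g}
        mul_mem' := by
          rintro _ _ ⟨u, hu, rfl⟩ ⟨v, hv, rfl⟩
          exact ⟨_, hu.mul hv, rfl⟩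
        one_mem' := ⟨_, IsGaugeFun.one, rfl⟩
        inv_mem' := by
          rintro _ ⟨u, hu, rfl⟩
          exact ⟨_, hu.inv, rfl⟩ }
    have hc : Continuous fun g : G => τ p * g * (τ p)⁻¹ := by fun_prop
    have hS : IsOpen (S : Set G) := by
      refine S.isOpen_of_mem_nhds (g := 1) (mem_of_superset
        ((hN.preimage hc).mem_nhds (show τ p * 1 * (τ p)⁻¹ ∈ N by simpa using h1N)) ?_)
      intro g hg
      -- The constant is conjugated by `τ p` beforehand so that the value at `p`, rather than at `σ
      -- (B.proj p)`, becomes `g`.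
      obtain ⟨u, hu, hu'⟩ := h (fun _ => τ p * g * (τ p)⁻¹)
        (Eventually.of_forall fun x => contMDiffAt_const) hg
      refine ⟨u, hu, ?_⟩
      rw [hu'.self_of_nhds p rfl]
      group
    have : (S : Set G) = Set.univ :=
      IsClopen.eq_univ ⟨S.isClosed_of_isOpen hS, hS⟩ ⟨1, S.one_mem⟩
    exact (this ▸ Set.mem_univ g : g ∈ (S : Set G))
  · choose τ hτ using fun p => act_transitive (B := B) (hσ' (B.proj p) trivial)
    have hts : ContMDiff 𝓘(ℝ, EP) 𝓘(ℝ, EG) ∞ τ := fun q =>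
      contMDiffAt_translation (a := fun q => σ (B.proj q)) (b := id)
        (((contMDiffOn_univ.1 hσ).comp B.contMDiff_proj).contMDiffAt) contMDiffAt_id
        (Eventually.of_forall hτ)
    have hact : ∀ q k, τ (B.act q k) = τ q * k := fun q k => by
      have h1 := hτ (B.act q k)
      rw [B.proj_act] at h1
      exact act_free (h1.trans (by rw [← B.act_mul, hτ]))
    refine ⟨fun q => (τ q)⁻¹ * (τ p * g * (τ p)⁻¹) * τ q,
      ⟨(hts.inv.mul contMDiff_const).mul hts, fun q k => ?_⟩, by group⟩
    rw [hact]
    group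

/-- If `G` is connected or `P` is trivial, then every local gauge section coincides near `m` with
the section defined by a global gauge transformation. -/
lemma exists_gau_eq_near (hGP : ConnectedSpace G ∨ ∃ σ : M → P, B.IsSectionOn σ Set.univ)
    {m : M} (s : LocalGauge B m) : ∃ f : Gau B,
      ∀ᶠ x in nhds m, ∀ p, B.proj p = x → f.toDiffeomorph.symm p = s.2.invMap p := by
  obtain ⟨U, σ, τ, hm, hU⟩ := exists_isLocalTriv B m
  obtain ⟨u₀, hu₀, hu₀'⟩ := exists_isGaugeFun_apply_eq (B := B) hGP (σ m) (B.gfun s.2.sec (σ m))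
  obtain ⟨N, hN, h1N, h⟩ := hU.exists_isGaugeFun_of_near_one hm
  -- The quotient of `s` by `u₀` equals 1 at `m`, so it is globalized by the near-identity case; the
  -- product `u₀ * u` then represents `s` near `m`.
  obtain ⟨u, hu, hu'⟩ := h (fun x => (u₀ (σ x))⁻¹ * B.gfun s.2.sec (σ x)) (by
    filter_upwards [U.isOpen.mem_nhds hm, s.1.1.isOpen.mem_nhds s.1.2] with x hx hxs
    have h1 : ContMDiffAt (𝓡 n) 𝓘(ℝ, EP) ∞ σ x :=
      hU.section_smooth.contMDiffAt (U.isOpen.mem_nhds hx)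
    have h2 : ContMDiffAt (𝓡 n) 𝓘(ℝ, EG) ∞ (fun x => u₀ (σ x)) x :=
      hu₀.smooth.contMDiffAt.comp x h1
    have h3 : ContMDiffAt (𝓡 n) 𝓘(ℝ, EG) ∞ (fun x => B.gfun s.2.sec (σ x)) x :=
      ContMDiffAt.comp (g := B.gfun s.2.sec) (f := σ) x (s.2.smooth.contMDiffAt ((isOpen_over s.1.1).mem_nhds (by
        rw [Set.mem_preimage, hU.proj_section x hx]; exact hxs))) h1
    exact h2.inv.mul h3) (by simpa [hu₀'] using h1N)
  refine ⟨(hu₀.mul hu).toGau, ?_⟩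
  filter_upwards [hu', U.isOpen.mem_nhds hm, s.1.1.isOpen.mem_nhds s.1.2] with x hx hxU hxs p hp
  have hps : B.proj p ∈ s.1.1 := hp ▸ hxs
  rw [IsGaugeFun.toGau_symm_apply, s.2.invMap_eq hps]
  congr 2
  -- By equivariance it suffices to compare both functions at the single point `σ x` of the fibre.
  have e : B.act (σ x) (τ p) = p := by rw [← hp]; exact hU.section_act_coord p (hp ▸ hxU)
  have e1 : u₀ p = (τ p)⁻¹ * u₀ (σ x) * τ p := by rw [← hu₀.apply_act, e]
  have e2 : B.gfun s.2.sec p = (τ p)⁻¹ * B.gfun s.2.sec (σ x) * τ p := by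
    rw [← s.2.gfun_act (by rw [hU.proj_section x hxU]; exact hxs), e]
  rw [hx p hp, e1, e2]
  group

end Gauge

/-- Tangent spaces are identified with the model space through the preferred chart at the base
point, where that chart is therefore infinitesimally the identity. -/
lemma tder_extChartAt_self {E N : Type*} [NormedAddCommGroup E] [NormedSpace ℝ E]
    [TopologicalSpace N] [ChartedSpace E N] [IsManifold 𝓘(ℝ, E) ∞ N] (x : N) :
    tder 𝓘(ℝ, E) 𝓘(ℝ, E) (extChartAt 𝓘(ℝ, E) x) x = ContinuousLinearMap.id ℝ E := by
  have h : MDifferentiableAt 𝓘(ℝ, E) 𝓘(ℝ, E) (extChartAt 𝓘(ℝ, E) x) x :=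
    (contMDiffAt_extChartAt (n := ∞)).mdifferentiableAt (by simp)
  rw [tder, h.mfderiv, modelWithCornersSelf_coe, Set.range_id, fderivWithin_univ]
  have : writtenInExtChartAt 𝓘(ℝ, E) 𝓘(ℝ, E) x (extChartAt 𝓘(ℝ, E) x)
      =ᶠ[nhds (extChartAt 𝓘(ℝ, E) x x)] id := by
    filter_upwards [(isOpen_extChartAt_target (I := 𝓘(ℝ, E)) x).mem_nhds
      (mem_extChartAt_target x)] with y hy
    exact (extChartAt 𝓘(ℝ, E) x).right_inv hy
  exact this.fderiv_eq.trans fderiv_id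

/-! ### Existence and gluing of connections -/

section Gauge

variable {n : ℕ} {EG EP M G P : Type*}
  [NormedAddCommGroup EG] [NormedSpace ℝ EG] [NormedAddCommGroup EP] [NormedSpace ℝ EP]
  [TopologicalSpace M] [ChartedSpace (EuclideanSpace ℝ (Fin n)) M]
  [TopologicalSpace G] [ChartedSpace EG G] [Group G]
  [TopologicalSpace P] [ChartedSpace EP P]
  {B : PrincipalBundle n EG EP M G P}
  [LieGroup 𝓘(ℝ, EG) ∞ G] [IsManifold 𝓘(ℝ, EP) ∞ P]

/-- The flat connection form `τ⁻¹ dτ` of a local trivialization is smooth. -/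
lemma IsLocalTriv.contMDiffAt_flat {U : Opens M} {σ : M → P} {τ : P → G}
    (hU : IsLocalTriv B U σ τ) {v : TangentBundle 𝓘(ℝ, EP) P} (hv : B.proj v.proj ∈ U) :
    ContMDiffAt 𝓘(ℝ, EP).tangent 𝓘(ℝ, EG) ∞
      (formFun fun p => tder 𝓘(ℝ, EP) 𝓘(ℝ, EG) (fun q => (τ p)⁻¹ * τ q) p) v := by
  have : IsManifold 𝓘(ℝ, EG) ∞ G := inferInstance
  set κ := extChartAt 𝓘(ℝ, EG) (1 : G)
  -- At `p` the flat form is the partial derivative of `D` in its second variable at `(p, p)`. Near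
  -- the diagonal `D` lies in the chart domain at 1, and `κ ∘ D` has the same derivative there
  -- because `κ` is infinitesimally the identity at 1.
  let D : P × P → G := fun z => (τ z.1)⁻¹ * τ z.2
  let V : Set (P × P) := (B.proj ⁻¹' U) ×ˢ (B.proj ⁻¹' U)
  have hV : IsOpen V := (isOpen_over U).prod (isOpen_over U)
  have hD : ContMDiffOn (𝓘(ℝ, EP).prod 𝓘(ℝ, EP)) 𝓘(ℝ, EG) ∞ D V :=
    (hU.coord_smooth.comp contMDiffOn_fst fun z hz => hz.1).inv.mul
      (hU.coord_smooth.comp contMDiffOn_snd fun z hz => hz.2)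
  let O : Set (P × P) := V ∩ D ⁻¹' (chartAt EG (1 : G)).source
  have hO : IsOpen O := hD.continuousOn.isOpen_inter_preimage hV (chartAt EG (1 : G)).open_source
  have hκ : ContMDiffOn 𝓘(ℝ, EG) 𝓘(ℝ, EG) ∞ κ (chartAt EG (1 : G)).source :=
    contMDiffOn_extChartAt
  have hF : ContMDiffOn (𝓘(ℝ, EP).prod 𝓘(ℝ, EP)) 𝓘(ℝ, EG) ∞ (fun z => κ (D z)) O :=
    hκ.comp (hD.mono Set.inter_subset_left) fun z hz => hz.2
  have hmem : ∀ p : P, B.proj p ∈ U → (p, p) ∈ O := fun p hp =>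
    ⟨⟨hp, hp⟩, by simp [D, mem_chart_source]⟩
  -- The lift `w ↦ (0, w)` over the diagonal selects the second partial derivative, so the form is a
  -- smooth tangent map composed with `ι`.
  let ι : TangentBundle 𝓘(ℝ, EP) P → TangentBundle (𝓘(ℝ, EP).prod 𝓘(ℝ, EP)) (P × P) :=
    fun w => (equivTangentBundleProd 𝓘(ℝ, EP) P 𝓘(ℝ, EP) P).symm
      (Bundle.zeroSection EP (TangentSpace 𝓘(ℝ, EP)) w.proj, w)
  have hι : ContMDiff 𝓘(ℝ, EP).tangent (𝓘(ℝ, EP).prod 𝓘(ℝ, EP)).tangent ∞ ι := by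
    have h1 : ContMDiff 𝓘(ℝ, EP).tangent 𝓘(ℝ, EP).tangent ∞
        (fun w : TangentBundle 𝓘(ℝ, EP) P =>
          Bundle.zeroSection EP (TangentSpace 𝓘(ℝ, EP)) w.proj) :=
      (Bundle.contMDiff_zeroSection ℝ (TangentSpace 𝓘(ℝ, EP) : P → Type _)).comp
        (Bundle.contMDiff_proj _)
    exact contMDiff_equivTangentBundleProd_symm.comp (h1.prodMk contMDiff_id)
  have hT : ContMDiffAt 𝓘(ℝ, EP).tangent 𝓘(ℝ, EG).tangent ∞
      (fun w => tangentMapWithin (𝓘(ℝ, EP).prod 𝓘(ℝ, EP)) 𝓘(ℝ, EG) (fun z => κ (D z)) O (ι w))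
      v := by
    refine ContMDiffAt.comp (I' := (𝓘(ℝ, EP).prod 𝓘(ℝ, EP)).tangent) (f := ι)
      (g := tangentMapWithin (𝓘(ℝ, EP).prod 𝓘(ℝ, EP)) 𝓘(ℝ, EG) (fun z => κ (D z)) O) v ?_
      hι.contMDiffAt
    refine (hF.contMDiffOn_tangentMapWithin (m := ∞) (by simp) hO.uniqueMDiffOn).contMDiffAt ?_
    exact (hO.preimage (FiberBundle.continuous_proj (EP × EP)
      (TangentSpace (𝓘(ℝ, EP).prod 𝓘(ℝ, EP)) : P × P → Type _))).mem_nhds (hmem _ hv)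
  refine ((contMDiff_snd_tangentBundle_modelSpace EG 𝓘(ℝ, EG)).contMDiffAt.comp v
    hT).congr_of_eventuallyEq ?_
  filter_upwards [((isOpen_over U).preimage (FiberBundle.continuous_proj EP
    (TangentSpace 𝓘(ℝ, EP)))).mem_nhds hv] with w hw
  have hw' := hmem _ hw
  change tder 𝓘(ℝ, EP) 𝓘(ℝ, EG) (fun q => (τ w.proj)⁻¹ * τ q) w.proj w.2 =
    mfderivWithin (𝓘(ℝ, EP).prod 𝓘(ℝ, EP)) 𝓘(ℝ, EG) (fun z => κ (D z)) O (w.proj, w.proj)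
      ((0, w.2) : EP × EP)
  have d1 : MDifferentiableAt (𝓘(ℝ, EP).prod 𝓘(ℝ, EP)) 𝓘(ℝ, EG) (fun z => κ (D z))
      (w.proj, w.proj) := (hF.contMDiffAt (hO.mem_nhds hw')).mdifferentiableAt (by simp)
  have e1 := mfderiv_prod_eq_add_apply d1 (v := ((0, w.2) : EP × EP))
  rw [mfderivWithin_of_isOpen hO hw']
  refine Eq.trans ?_ e1.symm
  have d2 : MDifferentiableAt 𝓘(ℝ, EP) 𝓘(ℝ, EG) (fun q => (τ w.proj)⁻¹ * τ q) w.proj :=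
    (contMDiffAt_const.mul (hU.coord_smooth.contMDiffAt
      ((isOpen_over U).mem_nhds hw))).mdifferentiableAt (by simp)
  have e2 := tder_comp (I'' := 𝓘(ℝ, EG)) (g := κ) (f := fun q => (τ w.proj)⁻¹ * τ q)
    (x := w.proj) (I := 𝓘(ℝ, EP)) (I' := 𝓘(ℝ, EG)) (by
      rw [inv_mul_cancel]
      exact (contMDiffAt_extChartAt (n := ∞)).mdifferentiableAt (by simp)) d2
  rw [inv_mul_cancel, tder_extChartAt_self, ContinuousLinearMap.id_comp] at e2
  have e3 : (mfderiv 𝓘(ℝ, EP) 𝓘(ℝ, EG) (fun z => κ (D (z, w.proj))) w.proj) (0 : EP) = (0 : EG) :=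
    map_zero _
  refine Eq.trans ?_ (congrArg₂ (fun a b : EG => a + b) e3.symm rfl)
  refine Eq.trans ?_ (zero_add _).symm
  exact congrArg (fun T : EP →L[ℝ] EG => T w.2) e2.symm

lemma ConnSection.form_act {U : Opens M} (A : ConnSection B U) {p : P} (hp : B.proj p ∈ U) (g : G)
    (v : EP) : A.form (B.act p g) (tder 𝓘(ℝ, EP) 𝓘(ℝ, EP) (fun q => B.act q g) p v)
      = AdInv EG g (A.form p v) := by
  rw [ConnSection.form, formOf_eq hp p rfl, formOf_eq hp (B.act p g) (B.proj_act p g)]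
  exact (A.sec ⟨_, hp⟩).equivariant p rfl g v

lemma ConnSection.form_vertical {U : Opens M} (A : ConnSection B U) {p : P} (hp : B.proj p ∈ U)
    (X : EG) : A.form p (fundamental B p X) = X := by
  rw [ConnSection.form, formOf_eq hp p rfl]
  exact (A.sec ⟨_, hp⟩).vertical p rfl X

/-- A smooth equivariant form that is the identity on vertical vectors is a connection. -/
lemma exists_connSection_form_eq {U : Opens M} (A : P → EP →L[ℝ] EG)
    (h1 : ∀ p, B.proj p ∈ U → ∀ (g : G) (v : EP),
      A (B.act p g) (tder 𝓘(ℝ, EP) 𝓘(ℝ, EP) (fun q => B.act q g) p v) = AdInv EG g (A p v))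
    (h2 : ∀ p, B.proj p ∈ U → ∀ X, A p (fundamental B p X) = X)
    (h3 : ∀ v : TangentBundle 𝓘(ℝ, EP) P, B.proj v.proj ∈ U →
      ContMDiffAt 𝓘(ℝ, EP).tangent 𝓘(ℝ, EG) ∞ (formFun A) v) :
    ∃ C : ConnSection B U, ∀ p, B.proj p ∈ U → C.form p = A p := by
  let sec : ∀ x : U, ConnFiber B x.1 := fun x =>
    { form := fun p _ => A p
      equivariant := fun p hp g v => h1 p (hp ▸ x.2) g v
      vertical := fun p hp X => h2 p (hp ▸ x.2) X }
  have h : ∀ p, B.proj p ∈ U → formOf B U sec p = A p := fun p hp => formOf_eq hp p rfl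
  refine ⟨⟨sec, fun v hv => ((h3 v hv).contMDiffWithinAt).congr (fun w hw => ?_) ?_⟩, h⟩
  · rw [formFun, formFun, h _ hw]
  · rw [formFun, formFun, h _ hv]

/-- The form is `τ⁻¹ dτ`. Both connection axioms come from differentiating `τ (q · g) = τ q * g`: in
`q` for equivariance, in `g` for the vertical normalization. -/
lemma IsLocalTriv.nonempty_connSection {U : Opens M} {σ : M → P} {τ : P → G}
    (hU : IsLocalTriv B U σ τ) : Nonempty (ConnSection B U) := by
  have hd : ∀ p, B.proj p ∈ U → ∀ a, MDifferentiableAt 𝓘(ℝ, EP) 𝓘(ℝ, EG)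
      (fun q => a * τ q) p := fun p hp a =>
    (contMDiffAt_const.mul (hU.coord_smooth.contMDiffAt
      ((isOpen_over U).mem_nhds hp))).mdifferentiableAt (by simp)
  refine (exists_connSection_form_eq (B := B) (U := U)
    (fun p => tder 𝓘(ℝ, EP) 𝓘(ℝ, EG) (fun q => (τ p)⁻¹ * τ q) p) ?_ ?_
    (fun v hv => hU.contMDiffAt_flat hv)).elim fun C _ => ⟨C⟩
  · intro p hp g v
    have hpg : B.proj (B.act p g) ∈ U := by rwa [B.proj_act]
    have e1 := tder_comp (I := 𝓘(ℝ, EP)) (I' := 𝓘(ℝ, EP)) (I'' := 𝓘(ℝ, EG)) (x := p)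
      (g := fun q => (τ (B.act p g))⁻¹ * τ q) (f := fun q => B.act q g) (hd _ hpg _)
      ((mdiff_act_right (B := B) g).mdifferentiableAt (by simp))
    have hc : MDifferentiableAt 𝓘(ℝ, EG) 𝓘(ℝ, EG) (fun h : G => g⁻¹ * h * g) 1 :=
      ((contMDiff_const.mul contMDiff_id).mul contMDiff_const).mdifferentiableAt
        (n := ∞) (by simp)
    have e2 := tder_comp (I := 𝓘(ℝ, EP)) (I' := 𝓘(ℝ, EG)) (I'' := 𝓘(ℝ, EG)) (x := p)
      (g := fun h : G => g⁻¹ * h * g) (f := fun q => (τ p)⁻¹ * τ q)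
      (by rw [inv_mul_cancel]; exact hc) (hd _ hp _)
    rw [inv_mul_cancel] at e2
    have e3 : (fun q => (τ (B.act p g))⁻¹ * τ (B.act q g)) =ᶠ[nhds p]
        fun q => g⁻¹ * ((τ p)⁻¹ * τ q) * g := by
      filter_upwards [(isOpen_over U).mem_nhds hp] with q hq
      rw [hU.coord_act hq, hU.coord_act hp]
      group
    rw [AdInv, ← ContinuousLinearMap.comp_apply, ← ContinuousLinearMap.comp_apply, ← e1, ← e2,
      tder_congr e3]
  · intro p hp X
    have e1 := tder_comp (I := 𝓘(ℝ, EG)) (I' := 𝓘(ℝ, EP)) (I'' := 𝓘(ℝ, EG)) (x := (1 : G))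
      (g := fun q => (τ p)⁻¹ * τ q) (f := fun g => B.act p g)
      (hd _ (by rwa [B.proj_act]) _) ((mdiff_act_left (B := B) p).mdifferentiableAt (by simp))
    have e2 : (fun g => (τ p)⁻¹ * τ (B.act p g)) = id := by
      funext g
      rw [hU.coord_act hp, inv_mul_cancel_left, id]
    rw [e2, B.act_one] at e1
    rw [fundamental, ← ContinuousLinearMap.comp_apply, ← e1]
    change mfderiv 𝓘(ℝ, EG) 𝓘(ℝ, EG) id (1 : G) X = X
    rw [mfderiv_id]
    rfl

lemma ConnSection.exists_restrict {U V : Opens M} (A : ConnSection B U) (hVU : V ≤ U) :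
    ∃ C : ConnSection B V, ∀ p, B.proj p ∈ V → C.form p = A.form p :=
  exists_connSection_form_eq A.form (fun _ hp => A.form_act (hVU hp))
    (fun _ hp => A.form_vertical (hVU hp))
    fun _ hv => A.smooth.contMDiffAt (((isOpen_over U).preimage
      (FiberBundle.continuous_proj EP (TangentSpace 𝓘(ℝ, EP)))).mem_nhds (hVU hv))

/-- A partition of unity glues connections. -/
lemma exists_connSection_glue {ι : Type*} {V : ι → Opens M} (C : ∀ i, ConnSection B (V i))
    (ρ : SmoothPartitionOfUnity ι (𝓡 n) M Set.univ)
    (hρ : ρ.IsSubordinate fun i => (V i : Set M)) :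
    ∃ A : ConnSection B ⊤, ∀ p, A.form p =
      ∑ i ∈ ρ.finsupport (B.proj p), ρ i (B.proj p) • (C i).form p := by
  have hmem : ∀ {x i}, i ∈ ρ.finsupport x → x ∈ V i := fun {x i} hi =>
    hρ i (subset_tsupport _ ((ρ.mem_finsupport x).1 hi))
  have happ : ∀ p (v : EP),
      (∑ i ∈ ρ.finsupport (B.proj p), ρ i (B.proj p) • (C i).form p) v =
        ∑ i ∈ ρ.finsupport (B.proj p), ρ i (B.proj p) • (C i).form p v := fun p v => by
    simp only [sum_apply, smul_apply]
  refine (exists_connSection_form_eq (B := B) (U := ⊤) (fun p =>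
    ∑ i ∈ ρ.finsupport (B.proj p), ρ i (B.proj p) • (C i).form p) ?_ ?_ ?_).elim
    fun A hA => ⟨A, fun p => hA p trivial⟩
  · intro p _ g v
    simp only [B.proj_act, sum_apply, smul_apply, map_sum, map_smul]
    exact Finset.sum_congr rfl fun i hi => by rw [(C i).form_act (hmem hi)]
  · intro p _ X
    -- The weights sum to 1, so averaging preserves the value on vertical vectors.
    rw [happ, Finset.sum_congr rfl fun i hi => by rw [(C i).form_vertical (hmem hi)],
      ← Finset.sum_smul, ρ.sum_finsupport _ trivial, one_smul]
  · intro v _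
    have hπ : ContMDiff 𝓘(ℝ, EP).tangent (𝓡 n) ∞
        (fun w : TangentBundle 𝓘(ℝ, EP) P => B.proj w.proj) :=
      B.contMDiff_proj.comp (Bundle.contMDiff_proj _)
    -- The index set of the finite sum varies with the point; as a `finsum` with fixed summands,
    -- smoothness follows from local finiteness.
    have hsum : formFun (fun p => ∑ i ∈ ρ.finsupport (B.proj p), ρ i (B.proj p) • (C i).form p)
        = fun w : TangentBundle 𝓘(ℝ, EP) P =>
          ∑ᶠ i, ρ i (B.proj w.proj) • formFun (C i).form w := by
      funext w
      rw [formFun, ← ρ.sum_finsupport_smul_eq_finsum (B.proj w.proj)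
        (fun i _ => formFun (C i).form w)]
      exact happ w.proj w.2
    rw [hsum]
    refine contMDiffAt_finsum ?_ fun i => ?_
    · refine ((ρ.locallyFinite.preimage_continuous hπ.continuous)).subset fun i w hw => ?_
      simp only [Set.mem_preimage, Function.mem_support] at hw ⊢
      exact fun h => hw (by rw [h, zero_smul])
    -- Outside `V i` the form of `C i` is only the default 0 and need not be smooth at the boundary,
    -- but there `ρ i` vanishes nearby.
    · by_cases hi : B.proj v.proj ∈ V i
      · exact (((ρ i).contMDiff.comp hπ).contMDiffAt).smul
          ((C i).smooth.contMDiffAt (((isOpen_over (V i)).preimage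
            (FiberBundle.continuous_proj EP (TangentSpace 𝓘(ℝ, EP)))).mem_nhds hi))
      · refine (contMDiffAt_const (c := (0 : EG))).congr_of_eventuallyEq ?_
        have hv : B.proj v.proj ∉ tsupport (ρ i) := fun h => hi (hρ i h)
        filter_upwards [((isClosed_tsupport (ρ i)).isOpen_compl.preimage hπ.continuous).mem_nhds
          hv] with w hw
        rw [Function.notMem_support.1 fun h => hw (subset_tsupport _ h), zero_smul]

variable [IsManifold (𝓡 n) ∞ M] [T2Space M] [SigmaCompactSpace M]

/-- Every germ of a connection is the germ of a global connection. -/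
lemma exists_connSection_eq_near {m : M} (A : LocalConn B m) : ∃ C : ConnSection B ⊤,
    ∀ᶠ x in nhds m, ∀ p, B.proj p = x → C.form p = A.2.form p := by
  -- A cover indexed by the points of `M` in which only the member of index `m` contains `m`, and
  -- this member carries the given connection.
  have key : ∀ i : M, ∃ V : Opens M, i ∈ V ∧ (i ≠ m → m ∉ V) ∧ ∃ C : ConnSection B V,
      i = m → ∀ᶠ x in nhds m, ∀ p, B.proj p = x → C.form p = A.2.form p := by
    intro i
    by_cases hi : i = m
    · exact ⟨A.1.1, hi ▸ A.1.2, fun h => (h hi).elim, A.2,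
        fun _ => Eventually.of_forall fun _ _ _ => rfl⟩
    · obtain ⟨U, σ, τ, hU, h⟩ := exists_isLocalTriv B i
      obtain ⟨C⟩ := h.nonempty_connSection
      let V : Opens M := U ⊓ ⟨{m}ᶜ, isOpen_compl_singleton⟩
      obtain ⟨C', -⟩ := C.exists_restrict (V := V) inf_le_left
      exact ⟨V, ⟨hU, hi⟩, fun _ h => h.2 rfl, C', fun h => (hi h).elim⟩
  choose V hV hVm C hC using key
  obtain ⟨ρ, hρ⟩ := SmoothPartitionOfUnity.exists_isSubordinate (𝓡 n) isClosed_univ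
    (fun i => (V i : Set M)) (fun i => (V i).isOpen) fun x _ => Set.mem_iUnion.2 ⟨x, hV x⟩
  obtain ⟨D, hD⟩ := exists_connSection_glue C ρ hρ
  refine ⟨D, ?_⟩
  filter_upwards [hC m rfl, ρ.eventually_finsupport_subset m] with x hx hxρ p hp
  -- Near `m` every active index has `m` in its closed support, hence in its `V i`; so only `ρ m`
  -- survives and it equals 1.
  have hsub : ρ.finsupport x ⊆ {m} := fun i hi => by
    rw [Finset.mem_singleton]
    by_contra him
    exact hVm i him (hρ i ((ρ.mem_fintsupport_iff m i).1 (hxρ hi)))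
  have h1 : ρ m x = 1 := by simpa using ρ.sum_finsupport' x trivial hsub
  rw [hD p, hp, ← hx p hp]
  rw [Finset.sum_subset hsub fun i _ hi => by
    rw [Function.notMem_support.1 fun h => hi ((ρ.mem_finsupport x).2 h), zero_smul]]
  simp [h1]

lemma JConn.exists_jet_eq {m : M} (j : JConn B m) : ∃ A : ConnSection B ⊤, A.jet m = j := by
  induction j using Quotient.inductionOn with
  | h A =>
    obtain ⟨C, hC⟩ := exists_connSection_eq_near A
    exact ⟨C, jetMk_congr hC⟩

variable [FiniteDimensional ℝ EP]

lemma j2Act_jet_exists_gau (hGP : ConnectedSpace G ∨ ∃ σ : M → P, B.IsSectionOn σ Set.univ)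
    {m : M} (a : J2Gauge B m) (A : ConnSection B ⊤) :
    ∃ f : Gau B, (f.act A).jet m = j2Act a (A.jet m) := by
  induction a using Quotient.inductionOn with
  | h s =>
    obtain ⟨f, hf⟩ := exists_gau_eq_near hGP s
    exact ⟨f, jet_act_eq_j2Act s f hf A⟩

end Gauge

/-! ### Top-degree forms in charts -/

lemma alternatingMap_comp_basis {n : ℕ} (α : EuclideanSpace ℝ (Fin n) [⋀^Fin n]→L[ℝ] ℝ)
    (T : EuclideanSpace ℝ (Fin n) →L[ℝ] EuclideanSpace ℝ (Fin n)) :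
    (α fun i => T (EuclideanSpace.single i 1)) =
      T.det * α fun i => EuclideanSpace.single i (1 : ℝ) := by
  set e := (EuclideanSpace.basisFun (Fin n) ℝ).toBasis with he
  have he' : ∀ i, e i = EuclideanSpace.single i (1 : ℝ) := by simp [he]
  have h1 := congrArg (fun f => f (T ∘ e)) (AlternatingMap.eq_smul_basis_det e α.toAlternatingMap)
  have h2 := Module.Basis.det_comp e (T : EuclideanSpace ℝ (Fin n) →ₗ[ℝ] _) e
  rw [e.det_self, mul_one] at h2
  have h3 : (α.toAlternatingMap : (Fin n → EuclideanSpace ℝ (Fin n)) → ℝ) (T ∘ e) =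
      α.toAlternatingMap e * e.det (T ∘ e) := by
    simpa using h1
  rw [show e.det (T ∘ e) = T.det from h2, mul_comm] at h3
  simpa [Function.comp_def, he', funext he'] using h3

lemma alternatingMap_ext_basis {n : ℕ} {α β : EuclideanSpace ℝ (Fin n) [⋀^Fin n]→L[ℝ] ℝ}
    (h : (α fun i => EuclideanSpace.single i (1 : ℝ)) = β fun i => EuclideanSpace.single i 1) :
    α = β := by
  set e := (EuclideanSpace.basisFun (Fin n) ℝ).toBasis with he
  have he' : (e : Fin n → EuclideanSpace ℝ (Fin n)) = fun i => EuclideanSpace.single i (1 : ℝ) := by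
    funext i; simp [he]
  apply ContinuousAlternatingMap.toAlternatingMap_injective
  rw [AlternatingMap.eq_smul_basis_det e α.toAlternatingMap,
    AlternatingMap.eq_smul_basis_det e β.toAlternatingMap, he']
  congr 1

section Coeff

variable {n : ℕ} {M : Type*} [TopologicalSpace M] [ChartedSpace (EuclideanSpace ℝ (Fin n)) M]
  [IsManifold (𝓡 n) ∞ M]

/-- At the centre of the chart the coordinate frame is the standard basis, and a top-degree form is
determined by its value on a basis. -/
lemma coeff_self_inj {m : M} {α β : TangentSpace (𝓡 n) m [⋀^Fin n]→L[ℝ] ℝ}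
    (h : coeff m m α = coeff m m β) : α = β := by
  have d : MDifferentiableAt (𝓡 n) (𝓡 n) (extChartAt (𝓡 n) m).symm (extChartAt (𝓡 n) m m) :=
    (contMDiffAt_chart_symm m (mem_extChartAt_target m)).mdifferentiableAt (by simp)
  have e1 := tder_comp (I := 𝓡 n) (I' := 𝓡 n) (I'' := 𝓡 n) (g := extChartAt (𝓡 n) m)
    (f := (extChartAt (𝓡 n) m).symm) (x := extChartAt (𝓡 n) m m)
    (by rw [extChartAt_to_inv]; exact (contMDiffAt_extChartAt (n := ∞)).mdifferentiableAt (by simp))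
    d
  rw [extChartAt_to_inv, tder_extChartAt_self, ContinuousLinearMap.id_comp] at e1
  have e2 : (fun z => extChartAt (𝓡 n) m ((extChartAt (𝓡 n) m).symm z))
      =ᶠ[nhds (extChartAt (𝓡 n) m m)] id := by
    filter_upwards [(isOpen_extChartAt_target (I := 𝓡 n) m).mem_nhds (mem_extChartAt_target m)]
      with y hy
    exact (extChartAt (𝓡 n) m).right_inv hy
  have e3 : tder (𝓡 n) (𝓡 n) (extChartAt (𝓡 n) m).symm (extChartAt (𝓡 n) m m)
      = ContinuousLinearMap.id ℝ _ := by
    rw [← e1, tder_congr e2]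
    exact mfderiv_id
  simp only [coeff, e3] at h
  exact alternatingMap_ext_basis h

lemma contDiffAt_transition {i j x : M} (hi : x ∈ (extChartAt (𝓡 n) i).source)
    (hj : x ∈ (extChartAt (𝓡 n) j).source) :
    ContDiffAt ℝ ∞ (hat (E := EuclideanSpace ℝ (Fin n)) (E' := EuclideanSpace ℝ (Fin n)) i j id)
      (extChartAt (𝓡 n) i x) :=
  contDiffAt_hat ((extChartAt (𝓡 n) i).map_source hi) contMDiffAt_id
    (by rwa [(extChartAt (𝓡 n) i).left_inv hi])

/-- The chain rule expresses one coordinate frame through the other by the Jacobian matrix, and a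
top-degree form scales by its determinant. -/
lemma coeff_transition {i j x : M} (hi : x ∈ (extChartAt (𝓡 n) i).source)
    (hj : x ∈ (extChartAt (𝓡 n) j).source) (α : TangentSpace (𝓡 n) x [⋀^Fin n]→L[ℝ] ℝ) :
    coeff i x α = (fderiv ℝ (hat (E := EuclideanSpace ℝ (Fin n))
      (E' := EuclideanSpace ℝ (Fin n)) i j id) (extChartAt (𝓡 n) i x)).det * coeff j x α := by
  set φ := hat (E := EuclideanSpace ℝ (Fin n)) (E' := EuclideanSpace ℝ (Fin n)) i j id
  have hφ : φ (extChartAt (𝓡 n) i x) = extChartAt (𝓡 n) j x := by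
    simp only [φ, hat, id, (extChartAt (𝓡 n) i).left_inv hi]
  have c1 := contDiffAt_transition hi hj
  have e1 := tder_comp (I := 𝓡 n) (I' := 𝓡 n) (I'' := 𝓡 n) (g := (extChartAt (𝓡 n) j).symm)
    (f := φ) (x := extChartAt (𝓡 n) i x)
    (by
      rw [hφ]
      exact (contMDiffAt_chart_symm j
        ((extChartAt (𝓡 n) j).map_source hj)).mdifferentiableAt (by simp))
    (c1.contMDiffAt.mdifferentiableAt (by simp))
  have e2 : (fun z => (extChartAt (𝓡 n) j).symm (φ z)) =ᶠ[nhds (extChartAt (𝓡 n) i x)]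
      (extChartAt (𝓡 n) i).symm := by
    have hx : (extChartAt (𝓡 n) i).symm (extChartAt (𝓡 n) i x) ∈ (extChartAt (𝓡 n) j).source := by
      rwa [(extChartAt (𝓡 n) i).left_inv hi]
    filter_upwards [(continuousAt_extChartAt_symm' hi).eventually
      ((isOpen_extChartAt_source (I := 𝓡 n) j).mem_nhds hx)] with z hz
    exact (extChartAt (𝓡 n) j).left_inv hz
  rw [tder_congr e2, hφ, tder_eq_fderiv] at e1
  have h := alternatingMap_comp_basis (ContinuousAlternatingMap.compContinuousLinearMap
    (show EuclideanSpace ℝ (Fin n) [⋀^Fin n]→L[ℝ] ℝ from α)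
    (tder (𝓡 n) (𝓡 n) (extChartAt (𝓡 n) j).symm (extChartAt (𝓡 n) j x)))
    (fderiv ℝ φ (extChartAt (𝓡 n) i x))
  rw [coeff, e1]
  exact h

lemma IsOrientedAtlas.det_transition_pos (hM : IsOrientedAtlas n M) {i j x : M}
    (hi : x ∈ (extChartAt (𝓡 n) i).source) (hj : x ∈ (extChartAt (𝓡 n) j).source) :
    0 < (fderiv ℝ (hat (E := EuclideanSpace ℝ (Fin n))
      (E' := EuclideanSpace ℝ (Fin n)) i j id) (extChartAt (𝓡 n) i x)).det := by
  rw [extChartAt_source] at hi hj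
  exact hM _ (chart_mem_atlas _ i) _ (chart_mem_atlas _ j) x ⟨hi, hj⟩

/-- This is where orientation enters: positive Jacobians make the comparison of coefficients
independent of the chart. -/
lemma coeff_lt_coeff (hM : IsOrientedAtlas n M) {i j x : M}
    (hi : x ∈ (extChartAt (𝓡 n) i).source) (hj : x ∈ (extChartAt (𝓡 n) j).source)
    {α β : TangentSpace (𝓡 n) x [⋀^Fin n]→L[ℝ] ℝ} (h : coeff j x α < coeff j x β) :
    coeff i x α < coeff i x β := by
  rw [coeff_transition hi hj, coeff_transition hi hj]
  exact mul_lt_mul_of_pos_left h (hM.det_transition_pos hi hj)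

variable (n) in
/-- An `n`-form is continuous if its coefficients are. -/
def IsContinuousForm (α : ∀ x : M, TangentSpace (𝓡 n) x [⋀^Fin n]→L[ℝ] ℝ) : Prop :=
  ∀ i : M, ContinuousOn (fun x => coeff i x (α x)) (extChartAt (𝓡 n) i).source

/-- A Lagrangian is controlled near `m` only in the chart centred at `m`; the continuous Jacobian
determinant carries this to all other charts. -/
lemma isContinuousForm_of_continuousAt {α : ∀ x : M, TangentSpace (𝓡 n) x [⋀^Fin n]→L[ℝ] ℝ}
    (h : ∀ m, ContinuousAt (fun x => coeff m x (α x)) m) : IsContinuousForm n α := by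
  intro i m hi
  refine ContinuousAt.continuousWithinAt ?_
  have hm := mem_extChartAt_source (I := 𝓡 n) m
  have c : ContinuousAt (fun x => (fderiv ℝ (hat (E := EuclideanSpace ℝ (Fin n))
      (E' := EuclideanSpace ℝ (Fin n)) i m id) (extChartAt (𝓡 n) i x)).det) m := by
    refine ContinuousLinearMap.continuous_det.continuousAt.comp ?_
    exact ContinuousAt.comp (g := fderiv ℝ (hat i m id))
      (contDiffAt_fderiv (contDiffAt_transition hi hm)).continuousAt
      (continuousAt_extChartAt' hi)
  refine (c.mul (h m)).congr ?_
  filter_upwards [(isOpen_extChartAt_source (I := 𝓡 n) i).mem_nhds hi,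
    (isOpen_extChartAt_source (I := 𝓡 n) m).mem_nhds hm] with x hxi hxm
  exact (coeff_transition hxi hxm _).symm

/-! ### Integration over compact sets -/

/-- The domain of integration in the chart at `i`. -/
def chartDomain (n : ℕ) {M : Type*} [TopologicalSpace M]
    [ChartedSpace (EuclideanSpace ℝ (Fin n)) M] (i : M) (K : Set M) :
    Set (EuclideanSpace ℝ (Fin n)) :=
  (extChartAt (𝓡 n) i).target ∩ (extChartAt (𝓡 n) i).symm ⁻¹' K

lemma isOpen_chartDomain (i : M) {V : Set M} (hV : IsOpen V) : IsOpen (chartDomain n i V) :=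
  (contMDiffOn_extChartAt_symm (I := 𝓡 n) (n := ∞) i).continuousOn.isOpen_inter_preimage
    (isOpen_extChartAt_target i) hV

lemma measurableSet_chartDomain (i : M) {K : Set M} (hK : IsClosed K) :
    MeasurableSet (chartDomain n i K) := by
  have : chartDomain n i K = (extChartAt (𝓡 n) i).target \ chartDomain n i Kᶜ := by
    ext y
    simp only [chartDomain, Set.mem_inter_iff, Set.mem_preimage, Set.mem_sdiff, Set.mem_compl_iff]
    tauto
  rw [this]
  exact (isOpen_extChartAt_target i).measurableSet.diff
    (isOpen_chartDomain i hK.isOpen_compl).measurableSet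

variable [T2Space M] [SigmaCompactSpace M]

lemma chartPartition_tsupport_subset (i : M) :
    tsupport (chartPartition n M i) ⊆ (extChartAt (𝓡 n) i).source := by
  rw [extChartAt_source]
  exact Classical.choose_spec (SmoothPartitionOfUnity.exists_isSubordinate_chartAt_source (𝓡 n) M) i

/-- The integrand in the chart at `i`. -/
def chartIntegrand (α : ∀ x : M, TangentSpace (𝓡 n) x [⋀^Fin n]→L[ℝ] ℝ) (i : M)
    (y : EuclideanSpace ℝ (Fin n)) : ℝ :=
  chartPartition n M i ((extChartAt (𝓡 n) i).symm y) *
    coeff i ((extChartAt (𝓡 n) i).symm y) (α ((extChartAt (𝓡 n) i).symm y))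

/-- `K` may leave the chart, but the integrand vanishes off the image of `K ∩ tsupport ρ_i`, which
is compact and lies in the chart target. -/
lemma integrableOn_chartIntegrand {α : ∀ x : M, TangentSpace (𝓡 n) x [⋀^Fin n]→L[ℝ] ℝ}
    (hα : IsContinuousForm n α) (i : M) {K : Set M} (hK : IsCompact K) :
    IntegrableOn (chartIntegrand α i) (chartDomain n i K) := by
  have hρ := chartPartition_tsupport_subset (n := n) i
  have hC : IsCompact (extChartAt (𝓡 n) i '' (K ∩ tsupport (chartPartition n M i))) :=
    (hK.inter_right (isClosed_tsupport _)).image_of_continuousOn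
      ((continuousOn_extChartAt (I := 𝓡 n) i).mono (Set.inter_subset_right.trans hρ))
  have hsub : extChartAt (𝓡 n) i '' (K ∩ tsupport (chartPartition n M i)) ⊆
      (extChartAt (𝓡 n) i).target := by
    rintro _ ⟨x, hx, rfl⟩
    exact (extChartAt (𝓡 n) i).map_source (hρ hx.2)
  have hc : ContinuousOn (chartIntegrand α i) (extChartAt (𝓡 n) i).target := by
    have hs := (contMDiffOn_extChartAt_symm (I := 𝓡 n) (n := ∞) i).continuousOn
    exact ((chartPartition n M i).contMDiff.continuous.comp_continuousOn hs).mul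
      ((hα i).comp hs fun y hy => (extChartAt (𝓡 n) i).map_target hy)
  refine ((hc.mono hsub).integrableOn_compact hC).of_forall_sdiff_eq_zero
    (measurableSet_chartDomain i hK.isClosed) ?_
  rintro y ⟨⟨hy, hyK⟩, hyC⟩
  rw [chartIntegrand]
  refine mul_eq_zero_of_left (Function.notMem_support.1 fun h => hyC ?_) _
  exact ⟨_, ⟨hyK, subset_tsupport _ h⟩, (extChartAt (𝓡 n) i).right_inv hy⟩

/-- By local finiteness only finitely many `ρ_i` meet `K`. The index set is independent of `α`, so
integrals of two forms can be subtracted termwise. -/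
lemma formIntegral_eq_sum {K : Set M} (hK : IsCompact K) : ∃ s : Finset M,
    (∀ i, ∀ x ∈ K, chartPartition n M i x ≠ 0 → i ∈ s) ∧
    ∀ α : ∀ x : M, TangentSpace (𝓡 n) x [⋀^Fin n]→L[ℝ] ℝ,
      formIntegral α K = ∑ i ∈ s, ∫ y in chartDomain n i K, chartIntegrand α i y := by
  have hfin := (chartPartition n M).locallyFinite.finite_nonempty_inter_compact hK
  have hmem : ∀ i, ∀ x ∈ K, chartPartition n M i x ≠ 0 → i ∈ hfin.toFinset :=
    fun i x hx h => hfin.mem_toFinset.2 ⟨x, h, hx⟩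
  refine ⟨hfin.toFinset, hmem, fun α => finsum_eq_sum_of_support_subset _ fun i hi => ?_⟩
  by_contra h
  refine hi (setIntegral_eq_zero_of_forall_eq_zero fun y hy => mul_eq_zero_of_left ?_ _)
  by_contra h0
  exact h (hmem i _ hy.2 h0)

/-- A continuous `n`-form is determined by its integrals over compact sets. -/
lemma eq_of_formIntegral_eq (hM : IsOrientedAtlas n M)
    {α β : ∀ x : M, TangentSpace (𝓡 n) x [⋀^Fin n]→L[ℝ] ℝ}
    (hα : IsContinuousForm n α) (hβ : IsContinuousForm n β)
    (h : ∀ K : Set M, IsCompact K → formIntegral α K = formIntegral β K) (m : M) :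
    α m = β m := by
  have : LocallyCompactSpace M := Manifold.locallyCompact_of_finiteDimensional (𝓡 n)
  -- One inequality suffices, by symmetry. If it failed, `β` would exceed `α` strictly on a compact
  -- neighbourhood `K` of `m`, and the integrals over `K` would differ.
  have key : ∀ {α β : ∀ x : M, TangentSpace (𝓡 n) x [⋀^Fin n]→L[ℝ] ℝ},
      IsContinuousForm n α → IsContinuousForm n β →
      (∀ K : Set M, IsCompact K → formIntegral α K = formIntegral β K) →
      coeff m m (β m) ≤ coeff m m (α m) := by
    intro α β hα hβ h
    by_contra! hlt
    have hms := (isOpen_extChartAt_source (I := 𝓡 n) m).mem_nhds (mem_extChartAt_source m)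
    have hW := ((hα m).continuousAt hms).eventually_lt ((hβ m).continuousAt hms) hlt
    obtain ⟨K, hKm, hKW, hK⟩ := local_compact_nhds (inter_mem hms hW)
    obtain ⟨s, hs, hsum⟩ := formIntegral_eq_sum (n := n) hK
    have hlt' : ∀ i, ∀ y ∈ chartDomain n i K,
        coeff i ((extChartAt (𝓡 n) i).symm y) (α ((extChartAt (𝓡 n) i).symm y)) <
          coeff i ((extChartAt (𝓡 n) i).symm y) (β ((extChartAt (𝓡 n) i).symm y)) :=
      fun i y hy => coeff_lt_coeff hM ((extChartAt (𝓡 n) i).map_target hy.1) (hKW hy.2).1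
        (hKW hy.2).2
    have hle : ∀ i, ∀ y ∈ chartDomain n i K, chartIntegrand α i y ≤ chartIntegrand β i y :=
      fun i y hy => mul_le_mul_of_nonneg_left (hlt' i y hy).le ((chartPartition n M).nonneg i _)
    have hint : ∀ i, 0 ≤ ∫ y in chartDomain n i K, (chartIntegrand β i y - chartIntegrand α i y) :=
      fun i => setIntegral_nonneg (measurableSet_chartDomain i hK.isClosed)
        fun y hy => sub_nonneg.2 (hle i y hy)
    have hsub : ∑ i ∈ s, ∫ y in chartDomain n i K, (chartIntegrand β i y - chartIntegrand α i y)
        = 0 := by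
      rw [Finset.sum_congr rfl fun i _ => integral_sub (integrableOn_chartIntegrand hβ i hK)
        (integrableOn_chartIntegrand hα i hK), Finset.sum_sub_distrib, ← hsum, ← hsum, h K hK,
        sub_self]
    -- The nonnegative chart contributions sum to 0, so each vanishes; a chart whose `ρ_i` is
    -- positive at `m` gives the contradiction.
    obtain ⟨i, hi⟩ := (chartPartition n M).exists_pos_of_mem (Set.mem_univ m)
    have hzero := (Finset.sum_eq_zero_iff_of_nonneg fun i _ => hint i).1 hsub i
      (hs i m (mem_of_mem_nhds hKm) hi.ne')
    refine hzero.not_gt ?_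
    rw [setIntegral_pos_iff_support_of_nonneg_ae]
    · have hmi : m ∈ (extChartAt (𝓡 n) i).source :=
        chartPartition_tsupport_subset i (subset_tsupport _ hi.ne')
      -- On the nonempty open set of chart points that map to the interior of `K` with `ρ_i > 0`,
      -- the difference of the integrands is strictly positive.
      have hO := isOpen_chartDomain (n := n) i ((isOpen_interior (s := K)).inter
        (isOpen_lt continuous_const (chartPartition n M i).contMDiff.continuous :
          IsOpen {x | 0 < chartPartition n M i x}))
      refine (hO.measure_pos volume ⟨extChartAt (𝓡 n) i m, (extChartAt (𝓡 n) i).map_source hmi,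
        ?_⟩).trans_le (measure_mono fun y hy => ?_)
      · rw [Set.mem_preimage, (extChartAt (𝓡 n) i).left_inv hmi]
        exact ⟨mem_interior_iff_mem_nhds.2 hKm, hi⟩
      · have hyK : y ∈ chartDomain n i K := ⟨hy.1,
          (interior_subset hy.2.1 : (extChartAt (𝓡 n) i).symm y ∈ K)⟩
        exact ⟨(sub_pos.2 (mul_lt_mul_of_pos_left (hlt' i y hyK) hy.2.2)).ne', hyK⟩
    · exact (ae_restrict_iff' (measurableSet_chartDomain i hK.isClosed)).2
        (Eventually.of_forall fun y hy => sub_nonneg.2 (hle i y hy))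
    · exact (integrableOn_chartIntegrand hβ i hK).sub (integrableOn_chartIntegrand hα i hK)
  exact coeff_self_inj (le_antisymm (key hβ hα fun K hK => (h K hK).symm) (key hα hβ h))

end Coeff

/-! ### Lagrangian densities and the two implications -/

section Lagrangian

variable {n : ℕ} {EG EP M G P : Type*}
  [NormedAddCommGroup EG] [NormedSpace ℝ EG] [NormedAddCommGroup EP] [NormedSpace ℝ EP]
  [TopologicalSpace M] [ChartedSpace (EuclideanSpace ℝ (Fin n)) M]
  [TopologicalSpace G] [ChartedSpace EG G] [Group G]
  [TopologicalSpace P] [ChartedSpace EP P]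
  {B : PrincipalBundle n EG EP M G P}
  [LieGroup 𝓘(ℝ, EG) ∞ G] [IsManifold 𝓘(ℝ, EP) ∞ P] [IsManifold (𝓡 n) ∞ M]

/-- In each fixed direction `v`, the potential is the smooth function on `TP` given by `A`, composed
with the tangent map of the section at `(z, v)`. -/
lemma contDiffOn_potential (A : ConnSection B ⊤) {x₀ : M} {σ : M → P} {U : Opens M}
    (hσ : B.IsSectionOn σ U) : ContDiffOn ℝ ∞ (potential x₀ σ A.form) (chartDomain n x₀ U) := by
  have hSo : IsOpen (chartDomain n x₀ (U : Set M)) := isOpen_chartDomain x₀ U.isOpen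
  have h0 : ContMDiffOn (𝓡 n) 𝓘(ℝ, EP) ∞ (fun z => σ ((extChartAt (𝓡 n) x₀).symm z))
      (chartDomain n x₀ U) :=
    hσ.1.comp ((contMDiffOn_extChartAt_symm (I := 𝓡 n) (n := ∞) x₀).mono Set.inter_subset_left)
      fun z hz => hz.2
  rw [contDiffOn_clm_apply]
  intro v
  have h1 : ContMDiffOn (𝓡 n).tangent 𝓘(ℝ, EP).tangent ∞
      (tangentMap (𝓡 n) 𝓘(ℝ, EP) (fun z => σ ((extChartAt (𝓡 n) x₀).symm z)))
      {w | w.proj ∈ chartDomain n x₀ (U : Set M)} := by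
    refine (h0.contMDiffOn_tangentMapWithin (m := ∞) (by simp) hSo.uniqueMDiffOn).congr ?_
    intro w hw
    rw [tangentMapWithin, tangentMap, mfderivWithin_of_isOpen hSo hw]
  have h2 : ContMDiffOn (𝓡 n) (𝓡 n).tangent ∞ (fun z : EuclideanSpace ℝ (Fin n) =>
      (⟨z, v⟩ : TangentBundle (𝓡 n) (EuclideanSpace ℝ (Fin n)))) (chartDomain n x₀ U) :=
    contMDiffOn_vectorSpace_iff_contDiffOn.2 contDiffOn_const
  have h3 := A.smooth.comp (h1.comp h2 (fun z hz => hz)) (fun z _ => Opens.mem_top _)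
  exact contMDiffOn_iff_contDiffOn.1 h3

/-- Near `m` the coefficient in the chart at `m` is `ℓ` evaluated on the coordinate, the potential
and its derivative, all of which vary continuously. -/
lemma GaugeLagrangian.isContinuousForm (L : GaugeLagrangian B) (A : ConnSection B ⊤) :
    IsContinuousForm n fun x => L.toFun x (A.jet x) := by
  refine isContinuousForm_of_continuousAt fun m => ?_
  obtain ⟨U, σ, ℓ, hm, hU, hσ, hℓ, h⟩ := L.smooth m
  set ψ := extChartAt (𝓡 n) m
  have himg : ψ '' U = chartDomain n m U := by
    rw [ψ.image_eq_target_inter_inv_preimage hU]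
    rfl
  have hSo : IsOpen (chartDomain n m (U : Set M)) := isOpen_chartDomain m U.isOpen
  have hmS : ψ m ∈ chartDomain n m (U : Set M) := himg ▸ Set.mem_image_of_mem _ hm
  have hp := (contDiffOn_potential (x₀ := m) A hσ).contDiffAt (hSo.mem_nhds hmS)
  have hψ : ContinuousAt ψ m := continuousAt_extChartAt m
  have c1 : ContinuousAt (fun x => (ψ x, potential m σ A.form (ψ x),
      fderiv ℝ (potential m σ A.form) (ψ x))) m :=
    hψ.prodMk ((ContinuousAt.comp (g := potential m σ A.form) hp.continuousAt hψ).prodMk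
      (ContinuousAt.comp (g := fderiv ℝ (potential m σ A.form))
        (contDiffAt_fderiv hp).continuousAt hψ))
  have c2 : ContinuousAt ℓ (ψ m, potential m σ A.form (ψ m),
      fderiv ℝ (potential m σ A.form) (ψ m)) :=
    hℓ.continuousOn.continuousAt
      (prod_mem_nhds (himg ▸ hSo.mem_nhds hmS) univ_mem)
  refine (ContinuousAt.comp (g := ℓ) (f := fun x => (ψ x, potential m σ A.form (ψ x),
    fderiv ℝ (potential m σ A.form) (ψ x))) c2 c1).congr ?_
  filter_upwards [U.isOpen.mem_nhds hm] with x hx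
  exact (h x hx ⟨⟨⊤, Opens.mem_top x⟩, A⟩).symm

variable [T2Space M] [SigmaCompactSpace M] [FiniteDimensional ℝ EP]

lemma GaugeLagrangian.IsJ2Invariant.isGaugeInvariant {L : GaugeLagrangian B}
    (h : L.IsJ2Invariant) : L.IsGaugeInvariant := by
  intro K _ f A
  have : (fun m => L.toFun m ((f.act A).jet m)) = fun m => L.toFun m (A.jet m) := by
    funext m
    obtain ⟨a, ha⟩ := jet_act_exists_j2 f A m
    rw [ha, h]
  rw [GaugeLagrangian.action, this, GaugeLagrangian.action]

/-- The jets `j` and `a · j` are those at `m` of a global `A` and of `f · A`, whose densities have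
equal integrals over all compact sets and hence coincide at `m`. -/
lemma GaugeLagrangian.IsGaugeInvariant.isJ2Invariant (hM : IsOrientedAtlas n M)
    {L : GaugeLagrangian B} (h : L.IsGaugeInvariant)
    (hGP : ConnectedSpace G ∨ ∃ σ : M → P, B.IsSectionOn σ Set.univ) : L.IsJ2Invariant := by
  intro m a j
  obtain ⟨A, rfl⟩ := j.exists_jet_eq
  obtain ⟨f, hf⟩ := j2Act_jet_exists_gau hGP a A
  rw [← hf]
  exact eq_of_formIntegral_eq hM (L.isContinuousForm _) (L.isContinuousForm _)
    (fun K hK => h K hK f A) m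

end Lagrangian

end GaugeField

end

theorem mainTheorem4 {n : ℕ} {EG EP M G P : Type*}
    [NormedAddCommGroup EG] [NormedSpace ℝ EG] [FiniteDimensional ℝ EG]
    [NormedAddCommGroup EP] [NormedSpace ℝ EP] [FiniteDimensional ℝ EP]
    [TopologicalSpace M] [ChartedSpace (EuclideanSpace ℝ (Fin n)) M] [IsManifold (𝓡 n) ∞ M]
    [T2Space M] [SigmaCompactSpace M] (hM : GaugeField.IsOrientedAtlas n M)
    [TopologicalSpace G] [ChartedSpace EG G] [Group G] [LieGroup 𝓘(ℝ, EG) ∞ G]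
    [TopologicalSpace P] [ChartedSpace EP P] [IsManifold 𝓘(ℝ, EP) ∞ P]
    (B : GaugeField.PrincipalBundle n EG EP M G P) (L : GaugeField.GaugeLagrangian B) :
    (L.IsJ2Invariant → L.IsGaugeInvariant) ∧
    ((ConnectedSpace G ∨ ∃ σ : M → P, B.IsSectionOn σ Set.univ) →
      (L.IsGaugeInvariant ↔ L.IsJ2Invariant)) := by
  exact ⟨fun h => h.isGaugeInvariant, fun hGP =>
    ⟨fun h => h.isJ2Invariant hM hGP, fun h => h.isGaugeInvariant⟩⟩
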